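/- **Theorem 1.3.** Let $X_n$ be $A_n$ (with $n\ge 1$) or $D_n$ (with $n\ge 3$), let $K$ be a division ring (a field if $X_n=D_n$), and let $K_0$ be a proper sub-division ring of $K$. *The geometries.* $A_n(K)$ is the geometry of the subspaces of dimensions $1,\dots,n$ of an $(n+1)$-dimensional $K$-vector space $V$; the type of an element is its dimension and incidence is symmetrized inclusion. Its diagram is the path $1-2-\cdots-n$. Let $E$ be any basis of $V$. For $D_n(K)$, let $V$ be a $2n$-dimensional $K$-vector space with a quadratic form $q$ and a basis $E=(e_1,\dots,e_{2n})$ with respect to which $q(x)=x_1x_2+x_3x_4+\dots+x_{2n-1}x_{2n}$. The elements of type $i\in\{1,\dots,n-2\}$ are the $i$-dimensional totally singular subspaces; the elements of types $+$ and $-$ are the members of the two classes of $n$-dimensional totally singular subspaces, where $X,Y$ are in the same class if and only if $X\cap Y$ has even codimension in $X$ (either class may be the one named $+$). Incidence is symmetrized inclusion, except that $X$ of type $+$ and $Y$ of type $-$ are incident when $\dim(X\cap Y)=n-1$. The diagram is the path $1-2-\cdots-(n-2)$ with two further nodes $+$ and $-$, each joined to $n-2$. *Grassmannians.* For a set $J$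 of nodes, $\mathrm{Gr}_J(X_n(K))$ is the point-line geometry whose points are the flags of type $J$ and whose lines are the flags of type $(J\setminus\{j\})\cup \mathrm{fr}(j)$, $j\in J$, where $\mathrm{fr}(j)$ is the set of nodes adjacent to $j$; a point and a line are incident when their union is a flag. A set of points is a *subspace* if it contains every point of each line that has at least two points in it; a set of points *generates* the geometry if the only subspace containing it is the set of all points. *Rationality.* A subspace of $V$ is $K_0$-rational (with respect to $E$) if it is spanned by vectors whose coordinates with respect to $E$ all lie in $K_0$. The geometry $\mathrm{Gr}_J(X_n(K))$ is *$K_0$-generated* if it is generated by the set of its points all of whose elements are $K_0$-rational, that is, by the points of its subgeometry $\mathrm{Gr}_J(X_n(K_0))$. *Claim.* If $J$ is non-connected, i.e. the subgraph of the diagram $X_n$ induced on $J$ is disconnected (in particular $|J|\ge 2$), then $\mathrm{Gr}_J(X_n(K))$ is not $K_0$-generated. -/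

import Mathlib

universe u v w

/-! Point-line geometries, subspaces and generation -/

/-- A point-line geometry: points, lines, and an incidence relation between them. -/
structure PointLineGeometry where
  Point : Type u
  Line : Type v
  Inc : Point → Line → Prop

/-- A set of points is a subspace if it contains all points of every line
of which it contains at least two distinct points. -/
def PointLineGeometry.IsSubspace (Γ : PointLineGeometry.{u, v}) (S : Set Γ.Point) : Prop :=
  ∀ (l : Γ.Line) (p q : Γ.Point), p ∈ S → q ∈ S → p ≠ q → Γ.Inc p l → Γ.Inc q l →
    ∀ r : Γ.Point, Γ.Inc r l → r ∈ S

/-- The subspace generated by a set of points: the intersection of all subspaces containing it. -/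
def PointLineGeometry.span (Γ : PointLineGeometry.{u, v}) (X : Set Γ.Point) : Set Γ.Point :=
  ⋂₀ {S : Set Γ.Point | Γ.IsSubspace S ∧ X ⊆ S}

/-- A set of points generates the geometry if the subspace it generates is the whole point-set. -/
def PointLineGeometry.Generates (Γ : PointLineGeometry.{u, v}) (X : Set Γ.Point) : Prop :=
  Γ.span X = Set.univ

/-! Geometries with a type function, flags and Grassmannians -/

/-- An incidence geometry over the type-set `I`. -/
structure TypedGeometry (I : Type u) where
  Elem : Type v
  typ : Elem → I
  Inc : Elem → Elem → Prop
  inc_refl : ∀ x, Inc x x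
  inc_symm : ∀ x y, Inc x y → Inc y x
  eq_of_inc : ∀ x y, Inc x y → typ x = typ y → x = y

/-- A flag is a set of pairwise incident elements. -/
def TypedGeometry.IsFlag {I : Type u} (Δ : TypedGeometry.{u, v} I) (F : Set Δ.Elem) : Prop :=
  ∀ x ∈ F, ∀ y ∈ F, Δ.Inc x y

/-- A flag of type `J`. -/
def TypedGeometry.IsFlagOfType {I : Type u} (Δ : TypedGeometry.{u, v} I) (J : Set I)
    (F : Set Δ.Elem) : Prop :=
  Δ.IsFlag F ∧ Δ.typ '' F = J

/-- The `J`-Grassmannian, as a point-line geometry, of a geometry `Δ` with diagram `D`.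
Its points are the `J`-flags of `Δ`, its lines are the flags of type `(J \ {j}) ∪ fr(j)`
for `j ∈ J`, where `fr(j)` is the set of nodes adjacent to `j`; a point and a line are
incident when their union is a flag. -/
def TypedGeometry.grassmannian {I : Type u} (Δ : TypedGeometry.{u, v} I) (D : SimpleGraph I)
    (J : Set I) : PointLineGeometry.{v, v} where
  Point := {F : Set Δ.Elem // Δ.IsFlagOfType J F}
  Line := {L : Set Δ.Elem // ∃ j ∈ J, Δ.IsFlagOfType ((J \ {j}) ∪ D.neighborSet j) L}
  Inc P L := Δ.IsFlag (P.1 ∪ L.1)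

/-- A set of nodes of a diagram is non-connected if two of its nodes are not joined by any path
inside it, that is, if the induced subgraph is disconnected. (The empty set of nodes
does not qualify, nor does a single node.) -/
def IsNonConnected {I : Type u} (D : SimpleGraph I) (J : Set I) : Prop :=
  ¬ (D.induce J).Preconnected

/-! Rational subspaces -/

/-- A subspace of `V` is `K₀`-rational with respect to the basis `E` if it is the span of
vectors all of whose coordinates with respect to `E` lie in the sub-division ring `K₀`.
(`Subfield K`, for a division ring `K`, is the type of sub-division rings of `K`.) -/
def IsRational {K : Type u} {V : Type v} {ι : Type w} [DivisionRing K] [AddCommGroup V]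
    [Module K V] (E : Module.Basis ι K V) (K₀ : Subfield K) (U : Submodule K V) : Prop :=
  ∃ S : Set V, (∀ s ∈ S, ∀ i, E.repr s i ∈ K₀) ∧ Submodule.span K S = U

/-! The geometry of type `A_n` -/

/-- The diagram `A_n`: a path with `n` nodes. The node `i : Fin n` stands for the type `i + 1`. -/
def diagramA (n : ℕ) : SimpleGraph (Fin n) := SimpleGraph.pathGraph n

/-- The geometry `A_n` of the vector space `V` (of dimension `n + 1`): its elements are the
subspaces of dimension `1, …, n`, the type of an element is its dimension (the node `i : Fin n`
stands for dimension `i + 1`) and incidence is symmetrized inclusion. -/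
noncomputable def geometryA (n : ℕ) (K : Type u) (V : Type v) [DivisionRing K] [AddCommGroup V] [Module K V] :
    TypedGeometry.{0, v} (Fin n) where
  Elem := {U : Submodule K V // 1 ≤ Module.finrank K U ∧ Module.finrank K U ≤ n}
  typ U := ⟨Module.finrank K U.1 - 1, by have := U.2; omega⟩
  Inc U W := U.1 ≤ W.1 ∨ W.1 ≤ U.1
  inc_refl U := Or.inl le_rfl
  inc_symm U W h := h.symm
  eq_of_inc U W h ht := by
    have h1 := U.2.1
    have h2 := W.2.1
    have hd : Module.finrank K U.1 = Module.finrank K W.1 := by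
      have := congrArg Fin.val ht
      simp only at this
      omega
    have : FiniteDimensional K U.1 := FiniteDimensional.of_finrank_pos h1
    have : FiniteDimensional K W.1 := FiniteDimensional.of_finrank_pos h2
    apply Subtype.ext
    rcases h with h | h
    · exact Submodule.eq_of_le_of_finrank_eq h hd
    · exact (Submodule.eq_of_le_of_finrank_eq h hd.symm).symm

/-- The points of the `J`-Grassmannian of `A_n` all of whose elements are `K₀`-rational with
respect to `E`, namely the points of the subgeometry `Gr_J(A_n(K₀))`. -/
def rationalPointsA {n : ℕ} {K : Type u} {V : Type v} {ι : Type w} [DivisionRing K]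
    [AddCommGroup V] [Module K V] (E : Module.Basis ι K V) (K₀ : Subfield K) (J : Set (Fin n)) :
    Set ((geometryA n K V).grassmannian (diagramA n) J).Point :=
  {P | ∀ X ∈ P.1, IsRational E K₀ X.1}

/-! The geometry of type `D_n` -/

/-- The nodes `1, …, n - 2, +, -` of the diagram `D_n`; `low i` stands for the type `i + 1`. -/
inductive NodeD (n : ℕ) : Type
  | low (i : Fin (n - 2))
  | plus
  | minus

/-- Adjacency in `D_n`: consecutive nodes among `1, …, n - 2` are adjacent, and the node `n - 2`
is adjacent to both `+` and `-`. -/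
def NodeD.Adj {n : ℕ} : NodeD n → NodeD n → Prop
  | .low i, .low j => i.val + 1 = j.val ∨ j.val + 1 = i.val
  | .low i, .plus => i.val + 1 = n - 2
  | .low i, .minus => i.val + 1 = n - 2
  | .plus, .low i => i.val + 1 = n - 2
  | .minus, .low i => i.val + 1 = n - 2
  | _, _ => False

/-- The diagram `D_n` (for `n ≥ 3`). -/
def diagramD (n : ℕ) : SimpleGraph (NodeD n) where
  Adj := NodeD.Adj
  symm := ⟨by
    intro a b h
    cases a <;> cases b <;> simp_all [NodeD.Adj, or_comm]⟩
  loopless := ⟨by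
    intro a h
    cases a <;> simp [NodeD.Adj] at h⟩

/-- A subspace is totally singular for `q` if `q` vanishes on it. -/
def IsTotallySingular {K : Type u} {V : Type v} [Field K] [AddCommGroup V] [Module K V]
    (q : QuadraticForm K V) (U : Submodule K V) : Prop :=
  ∀ x ∈ U, q x = 0

/-- The elements of `D_n`: the totally singular subspaces of dimension `1, …, n - 2` or `n`. -/
def ElemD (n : ℕ) {K : Type u} {V : Type v} [Field K] [AddCommGroup V] [Module K V]
    (q : QuadraticForm K V) : Type v :=
  {U : Submodule K V // IsTotallySingular q U ∧ 1 ≤ Module.finrank K U ∧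
    (Module.finrank K U ≤ n - 2 ∨ Module.finrank K U = n)}

open Classical in
/-- The type of an element of `D_n`. The `n`-dimensional totally singular subspaces fall into two
classes, `X` and `Y` being in the same class when `X ∩ Y` has even codimension in `X`; the class
of the given `n`-dimensional totally singular subspace `M₀` is named `+` and the other one `-`.
The type of an element of dimension `i ≤ n - 2` is `i`. -/
noncomputable def typeD {n : ℕ} {K : Type u} {V : Type v} [Field K] [AddCommGroup V] [Module K V]
    {q : QuadraticForm K V} (M₀ : Submodule K V) (U : ElemD n q) : NodeD n :=
  if h : Module.finrank K U.1 = n then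
    if Even (Module.finrank K U.1 - Module.finrank K (U.1 ⊓ M₀ : Submodule K V)) then .plus
    else .minus
  else .low ⟨Module.finrank K U.1 - 1, by have := U.2.2; omega⟩

/-- Incidence in `D_n`: symmetrized inclusion, except that an element of type `+` and an element
of type `-` are incident when they meet in dimension `n - 1` (neither of them can be
contained in the other). -/
def IncD {n : ℕ} {K : Type u} {V : Type v} [Field K] [AddCommGroup V] [Module K V]
    {q : QuadraticForm K V} (M₀ : Submodule K V) (U W : ElemD n q) : Prop :=
  (U.1 ≤ W.1 ∨ W.1 ≤ U.1) ∨
    (((typeD M₀ U = .plus ∧ typeD M₀ W = .minus) ∨ (typeD M₀ U = .minus ∧ typeD M₀ W = .plus)) ∧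
      Module.finrank K (U.1 ⊓ W.1 : Submodule K V) = n - 1)

theorem finrank_eq_of_typeD_eq {n : ℕ} {K : Type u} {V : Type v} [Field K] [AddCommGroup V]
    [Module K V] {q : QuadraticForm K V} (M₀ : Submodule K V) (U W : ElemD n q)
    (h : typeD M₀ U = typeD M₀ W) : Module.finrank K U.1 = Module.finrank K W.1 := by
  have hU := U.2.2
  have hW := W.2.2
  unfold typeD at h
  split_ifs at h <;> simp_all
  omega

/-- The geometry `D_n` of a vector space `V` with a quadratic form `q` (non-degenerate of Witt
index `n`, in dimension `2n`), the class of `M₀` being named `+`. -/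
noncomputable def geometryD (n : ℕ) {K : Type u} {V : Type v} [Field K] [AddCommGroup V]
    [Module K V] (q : QuadraticForm K V) (M₀ : Submodule K V) :
    TypedGeometry.{0, v} (NodeD n) where
  Elem := ElemD n q
  typ := typeD M₀
  Inc := IncD M₀
  inc_refl U := Or.inl (Or.inl le_rfl)
  inc_symm U W h := by
    rcases h with h | ⟨h, hd⟩
    · exact Or.inl h.symm
    · refine Or.inr ⟨?_, by rw [inf_comm]; exact hd⟩
      rcases h with h | h
      · exact Or.inr ⟨h.2, h.1⟩
      · exact Or.inl ⟨h.2, h.1⟩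
  eq_of_inc U W h ht := by
    have hd := finrank_eq_of_typeD_eq M₀ U W ht
    have : FiniteDimensional K U.1 := FiniteDimensional.of_finrank_pos U.2.2.1
    have : FiniteDimensional K W.1 := FiniteDimensional.of_finrank_pos W.2.2.1
    apply Subtype.ext
    rcases h with (h | h) | ⟨h, -⟩
    · exact Submodule.eq_of_le_of_finrank_eq h hd
    · exact (Submodule.eq_of_le_of_finrank_eq h hd.symm).symm
    · rcases h with h | h <;> rw [h.1, h.2] at ht <;> cases ht

/-- The points of the `J`-Grassmannian of `D_n` all of whose elements are `K₀`-rational with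
respect to `E`, namely the points of the subgeometry `Gr_J(D_n(K₀))`. -/
def rationalPointsD {n : ℕ} {K : Type u} {V : Type v} {ι : Type w} [Field K]
    [AddCommGroup V] [Module K V] (q : QuadraticForm K V) (M₀ : Submodule K V)
    (E : Module.Basis ι K V) (K₀ : Subfield K) (J : Set (NodeD n)) :
    Set ((geometryD n q M₀).grassmannian (diagramD n) J).Point :=
  {P | ∀ X ∈ P.1, IsRational E K₀ X.1}

/-! Two distinct nodes `i`, `k` of `J` give an obstruction to generation: a relation `G` between
elements of types `i` and `k` that spreads from two points of a line to the whole line. The flags of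
type `J` satisfying `G` then form a subspace. If `G` holds on all rational flags and fails on some
chamber, the part of that chamber with types in `J` is a point that the rational points do not
generate.

When one element `x` lies inside the other, `y`, the relation is that some rational `U` satisfies `x
≤ U ≤ y`. Moving `x` along a line replaces it by a subspace of `x ⊔ x'`, and moving `y` replaces it
by a subspace containing `y ⊓ y'`. The relation therefore spreads because sums and intersections of
rational subspaces are rational (`IsRational.sup`, `IsRational.inf`). It fails for a chamber
obtained from a coordinate chamber by a transvection-like map with a coefficient `α ∉ K₀`: its
members satisfy `x_b = x_a α`, which forces `x_a = 0` on every rational subspace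
(`IsRational.repr_eq_zero`), while the smallest member has a vector with `x_a ≠ 0`.

In `D_n` the pair `+`, `-` needs another relation, since neither element contains the other:
`RationalNear`. It spreads because a maximal totally singular subspace with a rational subspace `R`
of codimension at most one is rational (`IsHyperbolicBasis.isRational_of_le`). In codimension one,
`R^⊥/R` is a hyperbolic plane defined over `K₀`, whose two singular lines are rational. An isometry
with coefficient `α` again supplies the bad chamber, its two maximal members meeting in a subspace
with too few rational vectors. -/

namespace TypedGeometry

/-! ### Closed relations on a typed geometry and subspaces of its Grassmannians. -/

variable {I : Type u} (Δ : TypedGeometry.{u, v} I) (D : SimpleGraph I)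

/-- A relation between elements of type `i` and elements of type `k` is closed at `i` if, when the
element of type `i` moves along a line of type `i` of a Grassmannian, the relation holds everywhere
as soon as it holds at two positions. -/
def ClosedAt (i k : I) (G : Δ.Elem → Δ.Elem → Prop) : Prop :=
  ∀ x x' x'' y, Δ.typ x = i → Δ.typ x' = i → Δ.typ x'' = i → Δ.typ y = k → x ≠ x' →
    Δ.Inc x y → Δ.Inc x' y → Δ.Inc x'' y →
    (∀ a, D.Adj i a → ∃ b, Δ.typ b = a ∧ Δ.Inc x b ∧ Δ.Inc x' b ∧ Δ.Inc x'' b ∧ Δ.Inc y b) →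
    G x y → G x' y → G x'' y

variable {Δ D} {J : Set I}

/-- The elements of type other than `j` are common to all points of a line of type `j`. -/
theorem mem_of_mem_of_collinear {j : I} {P R L : Set Δ.Elem} (hP : Δ.IsFlagOfType J P)
    (hR : Δ.IsFlagOfType J R) (hL : Δ.IsFlagOfType ((J \ {j}) ∪ D.neighborSet j) L)
    (hPL : Δ.IsFlag (P ∪ L)) (hRL : Δ.IsFlag (R ∪ L)) {x : Δ.Elem} (hx : x ∈ R)
    (hxj : Δ.typ x ≠ j) : x ∈ P ∧ x ∈ L := by
  have hJ : Δ.typ x ∈ J := hR.2 ▸ Set.mem_image_of_mem _ hx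
  obtain ⟨z, hz, hzx⟩ : Δ.typ x ∈ Δ.typ '' P := by rw [hP.2]; exact hJ
  obtain ⟨w, hw, hwx⟩ : Δ.typ x ∈ Δ.typ '' L := by rw [hL.2]; exact Or.inl ⟨hJ, hxj⟩
  have h1 := Δ.eq_of_inc _ _ (hRL x (Or.inl hx) w (Or.inr hw)) hwx.symm
  have h2 := Δ.eq_of_inc _ _ (hPL z (Or.inl hz) w (Or.inr hw)) (hzx.trans hwx.symm)
  rw [h1]
  exact ⟨h2 ▸ hz, hw⟩

theorem ClosedAt.of_collinear {i k : I} {G : Δ.Elem → Δ.Elem → Prop} (hG : Δ.ClosedAt D i k G)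
    (hi : i ∈ J) (hik : i ≠ k) {P Q R L : Set Δ.Elem} (hP : Δ.IsFlagOfType J P)
    (hQ : Δ.IsFlagOfType J Q) (hR : Δ.IsFlagOfType J R)
    (hL : Δ.IsFlagOfType ((J \ {i}) ∪ D.neighborSet i) L) (hPL : Δ.IsFlag (P ∪ L))
    (hQL : Δ.IsFlag (Q ∪ L)) (hRL : Δ.IsFlag (R ∪ L)) (hPQ : P ≠ Q)
    (hGP : ∀ x ∈ P, ∀ y ∈ P, Δ.typ x = i → Δ.typ y = k → G x y)
    (hGQ : ∀ x ∈ Q, ∀ y ∈ Q, Δ.typ x = i → Δ.typ y = k → G x y) :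
    ∀ x ∈ R, ∀ y ∈ R, Δ.typ x = i → Δ.typ y = k → G x y := by
  intro x'' hx'' y hy hxi'' hyk
  have hyi : Δ.typ y ≠ i := by rw [hyk]; exact hik.symm
  obtain ⟨hyP, hyL⟩ := mem_of_mem_of_collinear hP hR hL hPL hRL hy hyi
  obtain ⟨hyQ, -⟩ := mem_of_mem_of_collinear hQ hR hL hQL hRL hy hyi
  obtain ⟨x, hx, hxi⟩ : i ∈ Δ.typ '' P := by rw [hP.2]; exact hi
  obtain ⟨x', hx', hxi'⟩ : i ∈ Δ.typ '' Q := by rw [hQ.2]; exact hi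
  refine hG x x' x'' y hxi hxi' hxi'' hyk ?_ (hP.1 _ hx _ hyP) (hQ.1 _ hx' _ hyQ)
    (hR.1 _ hx'' _ hy) ?_ (hGP _ hx _ hyP hxi hyk) (hGQ _ hx' _ hyQ hxi' hyk)
  -- Two points of a line of type `i` share all their elements of other types, so if their elements
  -- of type `i` also agreed the points would be equal.
  · rintro rfl
    apply hPQ
    ext z
    constructor
    · intro hz
      by_cases hzi : Δ.typ z = i
      · rwa [Δ.eq_of_inc _ _ (hP.1 _ hz _ hx) (hzi.trans hxi.symm)]
      · exact (mem_of_mem_of_collinear hQ hP hL hQL hPL hz hzi).1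
    · intro hz
      by_cases hzi : Δ.typ z = i
      · rwa [Δ.eq_of_inc _ _ (hQ.1 _ hz _ hx') (hzi.trans hxi.symm)]
      · exact (mem_of_mem_of_collinear hP hQ hL hPL hQL hz hzi).1
  · intro a ha
    obtain ⟨b, hb, hba⟩ : a ∈ Δ.typ '' L := by rw [hL.2]; exact Or.inr ha
    exact ⟨b, hba, hPL _ (Or.inl hx) _ (Or.inr hb), hQL _ (Or.inl hx') _ (Or.inr hb),
      hRL _ (Or.inl hx'') _ (Or.inr hb), hRL _ (Or.inl hy) _ (Or.inr hb)⟩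

/-- The flags of type `J` whose elements of types `i` and `k` are in a relation closed at `i` and
at `k` form a subspace of the Grassmannian. -/
theorem isSubspace_of_closedAt {i k : I} {G : Δ.Elem → Δ.Elem → Prop}
    (h1 : Δ.ClosedAt D i k G) (h2 : Δ.ClosedAt D k i (fun y x => G x y))
    (hi : i ∈ J) (hk : k ∈ J) (hik : i ≠ k) :
    (Δ.grassmannian D J).IsSubspace
      {P | ∀ x ∈ P.1, ∀ y ∈ P.1, Δ.typ x = i → Δ.typ y = k → G x y} := by
  rintro ⟨L, j, hj, hL⟩ ⟨P, hP⟩ ⟨Q, hQ⟩ hGP hGQ hPQ hPL hQL ⟨R, hR⟩ hRL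
  have hPQ' : P ≠ Q := fun h => hPQ (Subtype.ext h)
  by_cases hji : j = i
  · subst hji
    exact h1.of_collinear hj hik hP hQ hR hL hPL hQL hRL hPQ' hGP hGQ
  by_cases hjk : j = k
  · subst hjk
    have := h2.of_collinear hj hik.symm hP hQ hR hL hPL hQL hRL hPQ'
      (fun x hx y hy hxk hyi => hGP y hy x hx hyi hxk)
      (fun x hx y hy hxk hyi => hGQ y hy x hx hyi hxk)
    exact fun x hx y hy hxi hyk => this y hy x hx hyk hxi
  · intro x hx y hy hxi hyk
    exact hGP x (mem_of_mem_of_collinear hP hR hL hPL hRL hx (by rw [hxi]; exact Ne.symm hji)).1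
      y (mem_of_mem_of_collinear hP hR hL hPL hRL hy (by rw [hyk]; exact Ne.symm hjk)).1 hxi hyk

/-- A closed relation that holds between the distinguished elements, but not in some chamber,
prevents the flags of distinguished elements from generating the Grassmannian. -/
theorem not_generates_of_closedAt {i k : I} {G : Δ.Elem → Δ.Elem → Prop} {T : Δ.Elem → Prop}
    (h1 : Δ.ClosedAt D i k G) (h2 : Δ.ClosedAt D k i (fun y x => G x y))
    (hi : i ∈ J) (hk : k ∈ J) (hik : i ≠ k)
    (hT : ∀ x y, Δ.Inc x y → Δ.typ x = i → Δ.typ y = k → T x → T y → G x y)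
    {C : Set Δ.Elem} (hC : Δ.IsFlagOfType Set.univ C)
    (hGC : ∀ x ∈ C, ∀ y ∈ C, Δ.typ x = i → Δ.typ y = k → ¬ G x y) :
    ¬ (Δ.grassmannian D J).Generates {P | ∀ x ∈ P.1, T x} := by
  intro hgen
  let F : Set Δ.Elem := {x ∈ C | Δ.typ x ∈ J}
  have hF : Δ.IsFlagOfType J F := by
    refine ⟨fun x hx y hy => hC.1 x hx.1 y hy.1, Set.Subset.antisymm ?_ fun j hj => ?_⟩
    · rintro _ ⟨x, hx, rfl⟩
      exact hx.2
    · obtain ⟨x, hx, rfl⟩ : j ∈ Δ.typ '' C := by rw [hC.2]; trivial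
      exact ⟨x, ⟨hx, hj⟩, rfl⟩
  have hmem : (⟨F, hF⟩ : (Δ.grassmannian D J).Point) ∈
      (Δ.grassmannian D J).span {P | ∀ x ∈ P.1, T x} := by
    rw [show (Δ.grassmannian D J).span _ = Set.univ from hgen]; trivial
  have hS := Set.mem_sInter.1 hmem _ ⟨isSubspace_of_closedAt h1 h2 hi hk hik,
    fun P hP x hx y hy hxi hyk => hT x y (P.2.1 x hx y hy) hxi hyk (hP x hx) (hP y hy)⟩
  obtain ⟨x, hx, hxi⟩ : i ∈ Δ.typ '' F := by rw [hF.2]; exact hi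
  obtain ⟨y, hy, hyk⟩ : k ∈ Δ.typ '' F := by rw [hF.2]; exact hk
  exact hGC x hx.1 y hy.1 hxi hyk (hS x hx y hy hxi hyk)

end TypedGeometry

theorem IsNonConnected.nontrivial {I : Type u} {D : SimpleGraph I} {J : Set I}
    (h : IsNonConnected D J) : J.Nontrivial := by
  by_contra hJ
  have := (Set.not_nontrivial_iff.1 hJ).coe_sort
  exact h fun a b => by rw [Subsingleton.elim a b]

/-! ### The lattice of rational subspaces. -/

section Rational

variable {K : Type u} {V : Type v} {ι : Type w} [DivisionRing K] [AddCommGroup V] [Module K V]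
  {E : Module.Basis ι K V} {K₀ : Subfield K}

/-- The `K₀`-subspace of the vectors with coordinates in `K₀`. -/
def rationalVectors (E : Module.Basis ι K V) (K₀ : Subfield K) : Submodule K₀ V where
  carrier := {v | ∀ i, E.repr v i ∈ K₀}
  add_mem' ha hb i := by simpa using K₀.add_mem (ha i) (hb i)
  zero_mem' i := by simp
  smul_mem' c v hv i := by
    have : E.repr (c • v) i = (c : K) * E.repr v i := by
      rw [Subfield.smul_def, map_smul]; rfl
    rw [this]
    exact K₀.mul_mem c.2 (hv i)

theorem basis_mem_rationalVectors (i : ι) : E i ∈ rationalVectors E K₀ := by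
  classical
  intro j
  rw [E.repr_self, Finsupp.single_apply]
  split_ifs
  exacts [K₀.one_mem, K₀.zero_mem]

theorem isRational_span {S : Set V} (hS : S ⊆ rationalVectors E K₀) :
    IsRational E K₀ (Submodule.span K S) := ⟨S, hS, rfl⟩

theorem IsRational.span_inter {U : Submodule K V} (hU : IsRational E K₀ U) :
    Submodule.span K ((U : Set V) ∩ rationalVectors E K₀) = U := by
  obtain ⟨S, hS, rfl⟩ := hU
  refine le_antisymm (Submodule.span_le.2 Set.inter_subset_left) (Submodule.span_mono ?_)
  exact fun s hs => ⟨Submodule.subset_span hs, hS s hs⟩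

theorem IsRational.le_of_forall {U W : Submodule K V} (hU : IsRational E K₀ U)
    (h : ∀ x ∈ U, x ∈ rationalVectors E K₀ → x ∈ W) : U ≤ W := by
  rw [← hU.span_inter]
  exact Submodule.span_le.2 fun x hx => h x hx.1 hx.2

theorem IsRational.sup {U W : Submodule K V} (hU : IsRational E K₀ U) (hW : IsRational E K₀ W) :
    IsRational E K₀ (U ⊔ W) := by
  obtain ⟨S, hS, rfl⟩ := hU
  obtain ⟨T, hT, rfl⟩ := hW
  exact ⟨S ∪ T, fun s hs => hs.elim (hS s) (hT s), Submodule.span_union S T⟩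

theorem isRational_top : IsRational E K₀ (⊤ : Submodule K V) :=
  ⟨Set.range E, by rintro _ ⟨i, rfl⟩; exact basis_mem_rationalVectors i, E.span_eq⟩

/-- The basis of the `K₀`-space of rational vectors given by `E`. -/
noncomputable def rationalBasis [Finite ι] (E : Module.Basis ι K V) (K₀ : Subfield K) :
    Module.Basis ι K₀ (rationalVectors E K₀) :=
  Module.Basis.ofEquivFun
    { toFun := fun x i => ⟨E.repr x i, x.2 i⟩
      map_add' := fun x y => by ext i; simp
      map_smul' := fun c x => by
        ext i
        simp only [Submodule.coe_smul, RingHom.id_apply, Pi.smul_apply, smul_eq_mul,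
          Subfield.coe_mul, Subfield.smul_def, map_smul, Finsupp.smul_apply]
      invFun := fun f => ⟨E.equivFun.symm fun i => (f i : K), fun i => by
        rw [← E.equivFun_apply, LinearEquiv.apply_symm_apply]; exact (f i).2⟩
      left_inv := fun x => by
        ext
        simp only [← E.equivFun_apply]
        exact E.equivFun.symm_apply_apply _
      right_inv := fun f => by
        ext i
        simp only [← E.equivFun_apply]
        rw [LinearEquiv.apply_symm_apply] }

/-- `K₀`-independent rational vectors are `K`-independent. -/
theorem linearIndependent_of_rational [Finite ι] {κ : Type*} {f : κ → rationalVectors E K₀}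
    (hf : LinearIndependent K₀ f) : LinearIndependent K (fun i => (f i : V)) := by
  classical
  have := Fintype.ofFinite ι
  have b := rationalBasis E K₀
  have : Module.Finite K₀ (rationalVectors E K₀) := Module.Finite.of_basis b
  have : Module.Finite K V := Module.Finite.of_basis E
  -- A `K₀`-basis of the rational vectors extending `f` still spans `V` over `K`, because its span
  -- contains `E`. It has `dim V` members, hence is independent over `K`.
  let B := Module.Basis.sumExtend hf
  have := FiniteDimensional.fintypeBasisIndex B
  have hB : LinearIndependent K (fun s => (B s : V)) := by
    apply linearIndependent_of_top_le_span_of_card_eq_finrank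
    · rw [← E.span_eq, Submodule.span_le]
      rintro _ ⟨i, rfl⟩
      have : (⟨E i, basis_mem_rationalVectors i⟩ : rationalVectors E K₀) ∈
          Submodule.span K₀ (Set.range B) := by rw [B.span_eq]; trivial
      have h2 := Submodule.mem_map_of_mem (f := (rationalVectors E K₀).subtype) this
      rw [Submodule.map_span, ← Set.range_comp] at h2
      exact Submodule.span_le_restrictScalars K₀ K _ h2
    · rw [← Module.finrank_eq_card_basis B, Module.finrank_eq_card_basis b,
        Module.finrank_eq_card_basis E]
  have hc : (fun i => (f i : V)) = (fun s => (B s : V)) ∘ Sum.inl := by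
    ext i
    simp only [B, Module.Basis.sumExtend, Function.comp_apply, Module.Basis.reindex_apply,
      Module.Basis.extend_apply_self]
    rfl
  rw [hc]
  exact hB.comp _ Sum.inl_injective

/-- A `K₀`-basis of `A` stays independent over `K`. Dimension counts over `K` can thus be carried
out over `K₀`. -/
theorem finrank_span_of_rational [Finite ι] {A : Submodule K₀ V} (hA : A ≤ rationalVectors E K₀) :
    Module.finrank K (Submodule.span K (A : Set V)) = Module.finrank K₀ A := by
  have : Module.Finite K₀ (rationalVectors E K₀) := Module.Finite.of_basis (rationalBasis E K₀)
  have : Module.Finite K₀ A := Submodule.finiteDimensional_of_le hA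
  let b := Module.finBasis K₀ A
  have hb : LinearIndependent K₀ (fun i => (⟨b i, hA (b i).2⟩ : rationalVectors E K₀)) := by
    have := b.linearIndependent.map' (Submodule.inclusion hA)
      (LinearMap.ker_eq_bot.2 (Submodule.inclusion_injective hA))
    exact this
  have h2 := finrank_span_eq_card (linearIndependent_of_rational hb)
  rw [Fintype.card_fin] at h2
  have hspan : Submodule.span K (A : Set V) = Submodule.span K (Set.range fun i => (b i : V)) := by
    apply le_antisymm
    · rw [Submodule.span_le]
      intro x hx
      have : (⟨x, hx⟩ : A) ∈ Submodule.span K₀ (Set.range b) := by rw [b.span_eq]; trivial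
      have h2 := Submodule.mem_map_of_mem (f := A.subtype) this
      rw [Submodule.map_span, ← Set.range_comp] at h2
      exact Submodule.span_le_restrictScalars K₀ K _ h2
    · apply Submodule.span_mono
      rintro _ ⟨i, rfl⟩
      exact (b i).2
  rw [hspan]
  exact h2

/-- With `A`, `B` the rational vectors of `U`, `W`, the span of `A ⊓ B` lies in `U ⊓ W`. The
dimension formula over `K₀` for `A`, `B` and over `K` for `U`, `W` gives both the same dimension. -/
theorem IsRational.inf [Finite ι] {U W : Submodule K V} (hU : IsRational E K₀ U)
    (hW : IsRational E K₀ W) : IsRational E K₀ (U ⊓ W) := by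
  have : Module.Finite K V := Module.Finite.of_basis E
  have : Module.Finite K₀ (rationalVectors E K₀) := Module.Finite.of_basis (rationalBasis E K₀)
  let A := U.restrictScalars K₀ ⊓ rationalVectors E K₀
  let B := W.restrictScalars K₀ ⊓ rationalVectors E K₀
  have hA : A ≤ rationalVectors E K₀ := inf_le_right
  have hB : B ≤ rationalVectors E K₀ := inf_le_right
  have : Module.Finite K₀ A := Submodule.finiteDimensional_of_le hA
  have : Module.Finite K₀ B := Submodule.finiteDimensional_of_le hB
  have hAU : Submodule.span K (A : Set V) = U := hU.span_inter
  have hBW : Submodule.span K (B : Set V) = W := hW.span_inter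
  have hsup : Submodule.span K ((A ⊔ B : Submodule K₀ V) : Set V) = U ⊔ W := by
    apply le_antisymm
    · rw [Submodule.span_le]
      intro x hx
      obtain ⟨a, ha, b, hb, rfl⟩ := Submodule.mem_sup.1 hx
      exact Submodule.add_mem_sup ha.1 hb.1
    · conv_lhs => rw [← hAU, ← hBW]
      exact sup_le (Submodule.span_mono (SetLike.coe_subset_coe.2 le_sup_left))
        (Submodule.span_mono (SetLike.coe_subset_coe.2 le_sup_right))
  have hle : Submodule.span K ((A ⊓ B : Submodule K₀ V) : Set V) ≤ U ⊓ W :=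
    Submodule.span_le.2 fun x hx => ⟨hx.1.1, hx.2.1⟩
  have h1 := finrank_span_of_rational hA
  have h2 := finrank_span_of_rational hB
  have h3 := finrank_span_of_rational (sup_le hA hB)
  have h4 := finrank_span_of_rational (E := E) (A := A ⊓ B) (inf_le_left.trans hA)
  rw [hAU] at h1
  rw [hBW] at h2
  rw [hsup] at h3
  have h5 := Submodule.finrank_sup_add_finrank_inf_eq U W
  have h6 := Submodule.finrank_sup_add_finrank_inf_eq A B
  rw [← Submodule.eq_of_le_of_finrank_eq hle (by omega)]
  exact isRational_span fun x hx => hx.1.2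

/-- The kernel of a linear form with coefficients in `K₀` is rational. -/
theorem isRational_ker {f : V →ₗ[K] K} (hf : ∀ i, f (E i) ∈ K₀) :
    IsRational E K₀ (LinearMap.ker f) := by
  by_cases h0 : ∀ i, f (E i) = 0
  · have : f = 0 := E.ext (by simpa using h0)
    rw [this, LinearMap.ker_zero]
    exact isRational_top
  push Not at h0
  obtain ⟨i, hi⟩ := h0
  -- The projection onto `ker f` along `E i`; it sends basis vectors to rational vectors, and these
  -- span its image.
  let g : V →ₗ[K] V := LinearMap.id - (LinearMap.toSpanSingleton K V ((f (E i))⁻¹ • E i)).comp f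
  have hg : ∀ x, g x = x - (f x * (f (E i))⁻¹) • E i := fun x => by
    simp [g, mul_smul]
  refine ⟨Set.range fun j => g (E j), ?_, ?_⟩
  · rintro _ ⟨j, rfl⟩
    simp only [hg]
    have := (rationalVectors E K₀).sub_mem (basis_mem_rationalVectors j)
      ((rationalVectors E K₀).smul_mem ⟨f (E j) * (f (E i))⁻¹, K₀.mul_mem (hf j) (K₀.inv_mem (hf i))⟩
        (basis_mem_rationalVectors i))
    exact this
  · apply le_antisymm
    · rw [Submodule.span_le]
      rintro _ ⟨j, rfl⟩
      simp [hg, mul_assoc, inv_mul_cancel₀ hi]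
    · intro x hx
      have h1 : g x = x := by rw [hg, LinearMap.mem_ker.1 hx]; simp
      have h2 : Submodule.map g ⊤ = Submodule.span K (Set.range fun j => g (E j)) := by
        rw [← E.span_eq, Submodule.map_span, ← Set.range_comp]; rfl
      rw [← h2, ← h1]
      exact Submodule.mem_map_of_mem trivial

theorem isRational_iInf [Finite ι] {m : ℕ} {U : Fin m → Submodule K V}
    (hU : ∀ j, IsRational E K₀ (U j)) : IsRational E K₀ (⨅ j, U j) := by
  rw [← Finset.inf_univ_eq_iInf]
  exact Finset.inf_induction isRational_top (fun _ h _ h' => h.inf h') fun j _ => hU j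

/-- A rational subspace on which the coordinates satisfy `x_b = x_a α` with `α` outside `K₀`
lies in `x_a = 0`. -/
theorem IsRational.repr_eq_zero {U : Submodule K V} (hU : IsRational E K₀ U) {α : K}
    (hα : α ∉ K₀) {a b : ι} (h : ∀ x ∈ U, E.repr x b = E.repr x a * α) :
    ∀ x ∈ U, E.repr x a = 0 := by
  have : U ≤ LinearMap.ker (E.coord a) := by
    refine hU.le_of_forall fun x hx hx0 => ?_
    rw [LinearMap.mem_ker, E.coord_apply]
    -- A rational vector with `x_a ≠ 0` would give `α = x_a⁻¹ x_b ∈ K₀`.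
    by_contra hne
    apply hα
    rw [← inv_mul_cancel_left₀ hne α, ← h x hx]
    exact K₀.mul_mem (K₀.inv_mem (hx0 a)) (hx0 b)
  exact fun x hx => this hx

end Rational

/-! ### Coordinate subspaces and unipotent changes of basis. -/

section BasisSpan

variable {K : Type u} {V : Type v} {ι : Type w} [DivisionRing K] [AddCommGroup V] [Module K V]
  (E : Module.Basis ι K V)

theorem finrank_span_basis_image (s : Set ι) :
    Module.finrank K (Submodule.span K (E '' s)) = s.ncard := by
  have h := (E.linearIndependent.comp _ (Subtype.val_injective (p := (· ∈ s))))
  rw [Module.finrank_eq_nat_card_basis (Module.Basis.span h |>.map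
    (LinearEquiv.ofEq _ (Submodule.span K (E '' s)) (by rw [Set.range_comp, Subtype.range_coe]))),
    Nat.card_coe_set_eq]

theorem repr_eq_zero_of_mem_span_image {s : Set ι} {x : V} (hx : x ∈ Submodule.span K (E '' s))
    {i : ι} (hi : i ∉ s) : E.repr x i = 0 := by
  by_contra h
  exact hi (E.mem_span_image.1 hx (Finsupp.mem_support_iff.2 h))

theorem mem_span_basis_image {s : Set ι} {x : V} (hx : ∀ i, i ∉ s → E.repr x i = 0) :
    x ∈ Submodule.span K (E '' s) :=
  E.mem_span_image.2 fun i hi => by_contra fun h => Finsupp.mem_support_iff.1 hi (hx i h)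

/-- The basis obtained by applying `1 + N`, where `N * N = 0`. -/
noncomputable def unipotentBasis (N : V →ₗ[K] V) (hN : ∀ x, N (N x) = 0) : Module.Basis ι K V :=
  E.map (LinearEquiv.ofLinearMap (LinearMap.id + N) (LinearMap.id - N)
    (by ext; simp [hN]) (by ext; simp [hN]))

theorem unipotentBasis_repr (N : V →ₗ[K] V) (hN : ∀ x, N (N x) = 0) (x : V) (i : ι) :
    (unipotentBasis E N hN).repr x i = E.repr x i - E.repr (N x) i := by
  simp [unipotentBasis]

end BasisSpan

/-! ### Rational subspaces between two subspaces, and how the relation spreads along lines. -/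

section SubspaceLines

variable {K : Type u} {V : Type v} [DivisionRing K] [AddCommGroup V] [Module K V]

/-- Distinct subspaces of the same dimension `d` in a common subspace of dimension `d + 1`
span it. -/
theorem Submodule.le_sup_of_finrank_eq_succ {X X' B : Submodule K V} [FiniteDimensional K V]
    (hX : X ≤ B) (hX' : X' ≤ B) (h : Module.finrank K X = Module.finrank K X')
    (hB : Module.finrank K B ≤ Module.finrank K X + 1) (hne : X ≠ X') : B ≤ X ⊔ X' := by
  have h1 : X < X ⊔ X' := lt_of_le_of_ne le_sup_left fun h2 =>
    hne (Submodule.eq_of_le_of_finrank_eq (by rw [h2]; exact le_sup_right) h.symm).symm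
  have h2 := Submodule.finrank_lt_finrank_of_lt h1
  exact (Submodule.eq_of_le_of_finrank_le (sup_le hX hX') (by omega)).ge

/-- Distinct subspaces of the same dimension `d` through a common subspace of dimension `d - 1`
meet in it. -/
theorem Submodule.inf_le_of_finrank_eq_succ {Y Y' A : Submodule K V} [FiniteDimensional K V]
    (hY : A ≤ Y) (hY' : A ≤ Y') (h : Module.finrank K Y = Module.finrank K Y')
    (hA : Module.finrank K Y ≤ Module.finrank K A + 1) (hne : Y ≠ Y') : Y ⊓ Y' ≤ A := by
  have h1 : Y ⊓ Y' < Y := lt_of_le_of_ne inf_le_left fun h2 =>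
    hne (Submodule.eq_of_le_of_finrank_eq (by rw [← h2]; exact inf_le_right) h)
  have h2 := Submodule.finrank_lt_finrank_of_lt h1
  exact (Submodule.eq_of_le_of_finrank_le (le_inf hY hY') (by omega)).ge

variable {ι : Type w} (E : Module.Basis ι K V) (K₀ : Subfield K)

/-- There is a rational subspace between `X` and `Y`. -/
def RationalBetween (X Y : Submodule K V) : Prop :=
  ∃ U, IsRational E K₀ U ∧ X ≤ U ∧ U ≤ Y

variable {E K₀}

theorem RationalBetween.sup {X X' X'' Y : Submodule K V} (h : RationalBetween E K₀ X Y)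
    (h' : RationalBetween E K₀ X' Y) (hX : X'' ≤ X ⊔ X') : RationalBetween E K₀ X'' Y := by
  obtain ⟨U, hU, h1, h2⟩ := h
  obtain ⟨U', hU', h1', h2'⟩ := h'
  exact ⟨U ⊔ U', hU.sup hU', hX.trans (sup_le_sup h1 h1'), sup_le h2 h2'⟩

theorem RationalBetween.inf [Finite ι] {X Y Y' Y'' : Submodule K V}
    (h : RationalBetween E K₀ X Y) (h' : RationalBetween E K₀ X Y') (hY : Y ⊓ Y' ≤ Y'') :
    RationalBetween E K₀ X Y'' := by
  obtain ⟨U, hU, h1, h2⟩ := h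
  obtain ⟨U', hU', h1', h2'⟩ := h'
  exact ⟨U ⊓ U', hU.inf hU', le_inf h1 h1', (inf_le_inf h2 h2').trans hY⟩

theorem not_rationalBetween {X Y : Submodule K V} {α : K} (hα : α ∉ K₀) {a b : ι}
    (hY : ∀ x ∈ Y, E.repr x b = E.repr x a * α) {p : V} (hp : p ∈ X) (hpa : E.repr p a ≠ 0) :
    ¬ RationalBetween E K₀ X Y := by
  rintro ⟨U, hU, h1, h2⟩
  exact hpa (hU.repr_eq_zero hα (fun x hx => hY x (h2 hx)) p (h1 hp))

end SubspaceLines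

/-! ### The case of type `A_n`. -/

section TypeA

variable {n : ℕ} {K : Type u} {V : Type v} [DivisionRing K] [AddCommGroup V] [Module K V]

theorem geometryA_finrank {x : (geometryA n K V).Elem} {i : Fin n}
    (h : (geometryA n K V).typ x = i) : Module.finrank K x.1 = i + 1 := by
  have h1 := congrArg Fin.val h
  have h2 : ((geometryA n K V).typ x).val = Module.finrank K x.1 - 1 := rfl
  have := x.2.1
  omega

theorem geometryA_le_of_inc [FiniteDimensional K V] {x y : (geometryA n K V).Elem}
    (h : (geometryA n K V).Inc x y) (hxy : Module.finrank K x.1 < Module.finrank K y.1) :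
    x.1 ≤ y.1 :=
  h.resolve_right fun h => absurd (Submodule.finrank_mono h) (by omega)

theorem diagramA_adj {i j : Fin n} :
    (diagramA n).Adj i j ↔ i.val + 1 = j.val ∨ j.val + 1 = i.val :=
  SimpleGraph.pathGraph_adj

variable {ι : Type w} [Finite ι] {E : Module.Basis ι K V} {K₀ : Subfield K}

/-- The line carries an element `b` one dimension larger than `x`. It contains all three positions,
and two distinct ones already span it, so `x'' ≤ b ≤ x ⊔ x'`. -/
theorem closedAt_left_typeA {i k : Fin n} (hik : i < k) :
    (geometryA n K V).ClosedAt (diagramA n) i k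
      (fun x y => RationalBetween E K₀ x.1 y.1) := by
  have : Module.Finite K V := Module.Finite.of_basis E
  intro x x' x'' y hx hx' hx'' hy hne _ _ _ hadj hG hG'
  have hik' : i.val < k.val := hik
  obtain ⟨b, hb, h, h', h'', -⟩ := hadj ⟨i + 1, by omega⟩ (diagramA_adj.2 (Or.inl rfl))
  have hx := geometryA_finrank hx
  have hx' := geometryA_finrank hx'
  have hx'' := geometryA_finrank hx''
  have hb := geometryA_finrank hb
  simp only at hb
  refine hG.sup hG' ((geometryA_le_of_inc h'' (by omega)).trans
    (Submodule.le_sup_of_finrank_eq_succ (geometryA_le_of_inc h (by omega))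
      (geometryA_le_of_inc h' (by omega)) (by omega) (by omega) fun h => hne (Subtype.ext h)))

/-- Dual to `closedAt_left_typeA`: the line carries an element one dimension smaller, in which two
distinct positions meet and which lies in the third. -/
theorem closedAt_right_typeA {i k : Fin n} (hik : i < k) :
    (geometryA n K V).ClosedAt (diagramA n) k i
      (fun y x => RationalBetween E K₀ x.1 y.1) := by
  have : Module.Finite K V := Module.Finite.of_basis E
  intro x x' x'' y hx hx' hx'' hy hne _ _ _ hadj hG hG'
  have hik' : i.val < k.val := hik
  obtain ⟨b, hb, h, h', h'', -⟩ := hadj ⟨k - 1, by omega⟩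
    (diagramA_adj.2 (Or.inr (by simp only; omega)))
  have hx := geometryA_finrank hx
  have hx' := geometryA_finrank hx'
  have hx'' := geometryA_finrank hx''
  have hb := geometryA_finrank hb
  simp only at hb
  have hi := (geometryA n K V).inc_symm
  refine hG.inf hG' ((Submodule.inf_le_of_finrank_eq_succ
      (geometryA_le_of_inc (hi _ _ h) (by omega))
      (geometryA_le_of_inc (hi _ _ h') (by omega)) (by omega) (by omega)
      fun h => hne (Subtype.ext h)).trans (geometryA_le_of_inc (hi _ _ h'') (by omega)))

theorem not_generates_typeA (E : Module.Basis (Fin (n + 1)) K V) {J : Set (Fin n)}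
    (hJ : J.Nontrivial) (hK : K₀ ≠ ⊤) :
    ¬ ((geometryA n K V).grassmannian (diagramA n) J).Generates (rationalPointsA E K₀ J) := by
  obtain ⟨i, hi, k, hk, hik⟩ := hJ.exists_lt
  obtain ⟨α, hα⟩ : ∃ α, α ∉ K₀ := by
    by_contra! h
    exact hK (SetLike.ext fun x => by simp [h x])
  have : Module.Finite K V := Module.Finite.of_basis E
  have hik' : i.val < k.val := hik
  have hkn := k.2
  let a : Fin (n + 1) := ⟨0, by omega⟩
  let b : Fin (n + 1) := ⟨1, by omega⟩
  have hab : a ≠ b := by simp [a, b]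
  -- `1 + N` is a transvection sending `E a` to `E a + α • E b`. Vanishing of the new `b`-coordinate
  -- means `x_b = x_a α` in the old coordinates.
  let N : V →ₗ[K] V := (LinearMap.toSpanSingleton K V (α • E b)).comp (E.coord a)
  have hNa : ∀ x, N x = (E.repr x a * α) • E b := fun x => by simp [N, mul_smul]
  have hN : ∀ x, N (N x) = 0 := fun x => by
    rw [hNa, hNa]; simp [hab.symm]
  let E' := unipotentBasis E N hN
  have hE'a : ∀ x, E'.repr x a = E.repr x a := fun x => by
    rw [unipotentBasis_repr, hNa]; simp [hab.symm]
  have hE'b : ∀ x, E'.repr x b = E.repr x b - E.repr x a * α := fun x => by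
    rw [unipotentBasis_repr, hNa]; simp
  -- An enumeration of all indices except `b`, starting with `a`: every member of the chamber
  -- contains `E' a` and has zero `b`-coordinate in `E'`.
  let g : Fin n → Fin (n + 1) := fun j => if j.val = 0 then a else j.succ
  have hg : Function.Injective g := by
    intro j j' h
    have h := congrArg Fin.val h
    ext
    dsimp only [g, a] at h
    split_ifs at h <;> simp at h
    all_goals omega
  have hgb : ∀ j, g j ≠ b := by
    intro j h
    have h := congrArg Fin.val h
    dsimp only [g, a, b] at h
    split_ifs at h <;> simp at h
    all_goals omega
  let X : Fin n → Submodule K V := fun m => Submodule.span K (E' '' (g '' Set.Iic m))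
  have hX : ∀ m, Module.finrank K (X m) = m + 1 := fun m => by
    rw [finrank_span_basis_image, Set.ncard_image_of_injective _ hg, ← Finset.coe_Iic,
      Set.ncard_coe_finset, Fin.card_Iic]
  have hmono : Monotone X := fun m m' h =>
    Submodule.span_mono (Set.image_mono (Set.image_mono (Set.Iic_subset_Iic.2 h)))
  let c : Fin n → (geometryA n K V).Elem := fun m =>
    ⟨X m, by rw [hX]; exact ⟨by omega, m.2⟩⟩
  have hc : ∀ m, (geometryA n K V).typ (c m) = m := fun m => by
    apply Fin.ext
    change Module.finrank K (X m) - 1 = m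
    rw [hX]; rfl
  refine TypedGeometry.not_generates_of_closedAt
    (T := fun x : (geometryA n K V).Elem => IsRational E K₀ x.1)
    (closedAt_left_typeA (E := E) (K₀ := K₀) hik)
    (closedAt_right_typeA (E := E) (K₀ := K₀) hik) hi hk hik.ne ?_ (C := Set.range c) ?_ ?_
  · intro x y hxy hx hy hxr _
    have hx := geometryA_finrank hx
    have hy := geometryA_finrank hy
    exact ⟨x.1, hxr, le_rfl, geometryA_le_of_inc hxy (by omega)⟩
  · refine ⟨?_, Set.eq_univ_of_forall fun m => ⟨c m, ⟨m, rfl⟩, hc m⟩⟩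
    rintro _ ⟨m, rfl⟩ _ ⟨m', rfl⟩
    exact (le_total m m').imp (fun h => hmono h) (fun h => hmono h)
  · rintro _ ⟨m, rfl⟩ _ ⟨m', rfl⟩ - -
    refine not_rationalBetween hα (a := a) (b := b) (p := E' a) (fun x hx => ?_) ?_ ?_
    · rw [← sub_eq_zero, ← hE'b]
      exact repr_eq_zero_of_mem_span_image E' hx (by rintro ⟨j, -, hj⟩; exact hgb j hj)
    · exact Submodule.subset_span ⟨a, ⟨⟨0, by omega⟩, by simp [Fin.le_def], by simp [g]⟩, rfl⟩
    · rw [← hE'a]; simp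

end TypeA

/-! ### Maximal totally singular subspaces and their two classes. -/

section Quadratic

open QuadraticMap Module

variable {K : Type u} {V : Type v} [Field K] [AddCommGroup V] [Module K V]
  {q : QuadraticForm K V}

/-- The orthogonal of a subspace for the polar form of `q`. -/
def polarOrthogonal (q : QuadraticForm K V) (U : Submodule K V) : Submodule K V :=
  LinearMap.BilinForm.orthogonal q.polarBilin U

theorem mem_polarOrthogonal {U : Submodule K V} {x : V} :
    x ∈ polarOrthogonal q U ↔ ∀ y ∈ U, polar q y x = 0 := Iff.rfl

theorem polarOrthogonal_anti {U W : Submodule K V} (h : U ≤ W) :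
    polarOrthogonal q W ≤ polarOrthogonal q U := fun _ hx y hy => hx y (h hy)

theorem finrank_polarOrthogonal [FiniteDimensional K V] (hB : q.polarBilin.Nondegenerate)
    (U : Submodule K V) : finrank K (polarOrthogonal q U) = finrank K V - finrank K U :=
  LinearMap.BilinForm.finrank_orthogonal hB U

theorem IsTotallySingular.mono {U W : Submodule K V} (h : IsTotallySingular q W) (hU : U ≤ W) :
    IsTotallySingular q U := fun x hx => h x (hU hx)

theorem IsTotallySingular.polar_eq_zero {U : Submodule K V} (h : IsTotallySingular q U)
    {x y : V} (hx : x ∈ U) (hy : y ∈ U) : polar q x y = 0 := by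
  rw [polar, h _ (U.add_mem hx hy), h x hx, h y hy]; simp

theorem IsTotallySingular.le_orthogonal {U : Submodule K V} (h : IsTotallySingular q U) :
    U ≤ polarOrthogonal q U := fun _ hx _ hy => h.polar_eq_zero hy hx

theorem IsTotallySingular.le_orthogonal_of_le {U W : Submodule K V} (h : IsTotallySingular q W)
    (hU : U ≤ W) : W ≤ polarOrthogonal q U := fun _ hx _ hy => h.polar_eq_zero (hU hy) hx

theorem IsTotallySingular.sup {U W : Submodule K V} (hU : IsTotallySingular q U)
    (hW : IsTotallySingular q W) (h : W ≤ polarOrthogonal q U) :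
    IsTotallySingular q (U ⊔ W) := by
  intro x hx
  obtain ⟨a, ha, b, hb, rfl⟩ := Submodule.mem_sup.1 hx
  rw [QuadraticMap.map_add q, hU a ha, hW b hb, mem_polarOrthogonal.1 (h hb) a ha]
  simp

theorem isTotallySingular_span_singleton {x : V} (hx : q x = 0) :
    IsTotallySingular q (Submodule.span K {x}) := by
  intro y hy
  obtain ⟨c, rfl⟩ := Submodule.mem_span_singleton.1 hy
  rw [QuadraticMap.map_smul, hx, smul_zero]

variable [FiniteDimensional K V] {n : ℕ}

/-- A maximal totally singular subspace is its own orthogonal. -/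
theorem IsTotallySingular.orthogonal_eq (hB : q.polarBilin.Nondegenerate)
    (hV : finrank K V = 2 * n) {M : Submodule K V} (hM : IsTotallySingular q M)
    (hn : finrank K M = n) : polarOrthogonal q M = M :=
  (Submodule.eq_of_le_of_finrank_eq hM.le_orthogonal
    (by rw [finrank_polarOrthogonal hB, hV, hn]; omega)).symm

/-- The projection of a maximal totally singular subspace to the residue of `A`. -/
theorem IsTotallySingular.projection (hB : q.polarBilin.Nondegenerate)
    (hV : finrank K V = 2 * n) {M A : Submodule K V} (hM : IsTotallySingular q M)
    (hn : finrank K M = n) (hA : IsTotallySingular q A) :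
    finrank K (M ⊓ polarOrthogonal q A : Submodule K V) + finrank K A =
      n + finrank K (M ⊓ A : Submodule K V) ∧
    IsTotallySingular q (A ⊔ M ⊓ polarOrthogonal q A) ∧
    finrank K (A ⊔ M ⊓ polarOrthogonal q A : Submodule K V) = n := by
  -- The orthogonal of a sum is the intersection of the orthogonals, and `M` is its own orthogonal;
  -- the dimension of `M ⊓ A^⊥` follows.
  have h1 : polarOrthogonal q (M ⊔ A) = M ⊓ polarOrthogonal q A := by
    apply le_antisymm
    · refine le_inf ?_ (polarOrthogonal_anti le_sup_right)
      conv_rhs => rw [← hM.orthogonal_eq hB hV hn]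
      exact polarOrthogonal_anti le_sup_left
    · rintro x ⟨hx, hx'⟩ y hy
      obtain ⟨a, ha, b, hb, rfl⟩ := Submodule.mem_sup.1 hy
      rw [_root_.map_add, LinearMap.add_apply]
      have e1 : q.polarBilin a x = 0 := hM.polar_eq_zero ha hx
      have e2 : q.polarBilin b x = 0 := hx' b hb
      change q.polarBilin a x + q.polarBilin b x = 0
      rw [e1, e2, add_zero]
  have h2 := finrank_polarOrthogonal hB (M ⊔ A)
  have h3 := Submodule.finrank_sup_add_finrank_inf_eq M A
  have h4 := Submodule.finrank_le (M ⊔ A)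
  have h5 := Submodule.finrank_sup_add_finrank_inf_eq A (M ⊓ polarOrthogonal q A)
  have h6 : A ⊓ (M ⊓ polarOrthogonal q A) = M ⊓ A :=
    le_antisymm (le_inf (inf_le_right.trans inf_le_left) inf_le_left)
      (le_inf inf_le_right (le_inf inf_le_left (inf_le_right.trans hA.le_orthogonal)))
  rw [h1] at h2
  rw [h6] at h5
  have h7 : finrank K (M ⊓ polarOrthogonal q A : Submodule K V) + finrank K A =
      n + finrank K (M ⊓ A : Submodule K V) := by omega
  exact ⟨h7, hA.sup (hM.mono inf_le_left) inf_le_right, by omega⟩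

/-- At most two maximal totally singular subspaces contain a given subspace of dimension
`n - 1`. -/
theorem IsTotallySingular.eq_or_eq (hB : q.polarBilin.Nondegenerate)
    (hV : finrank K V = 2 * n) {P Q M : Submodule K V} (hP : IsTotallySingular q P)
    (hPn : finrank K P = n) (hQ : IsTotallySingular q Q) (hQn : finrank K Q = n)
    (hPQ : finrank K (P ⊓ Q : Submodule K V) + 1 = n)
    (hM : IsTotallySingular q M) (hMn : finrank K M = n) (hPQM : P ⊓ Q ≤ M) :
    M = P ∨ M = Q := by
  -- A group is not the union of two proper subgroups, so it suffices to place each vector of `M` in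
  -- `P` or in `Q`.
  suffices h : (M : Set V) ⊆ P ∪ Q by
    exact (AddSubgroupClass.subset_union.1 h).imp
      (fun h => Submodule.eq_of_le_of_finrank_eq h (hMn.trans hPn.symm))
      (fun h => Submodule.eq_of_le_of_finrank_eq h (hMn.trans hQn.symm))
  have hsup : polarOrthogonal q (P ⊓ Q) = P ⊔ Q := by
    refine (Submodule.eq_of_le_of_finrank_eq
      (sup_le (hP.le_orthogonal_of_le inf_le_left) (hQ.le_orthogonal_of_le inf_le_right)) ?_).symm
    have := Submodule.finrank_sup_add_finrank_inf_eq P Q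
    rw [finrank_polarOrthogonal hB]
    omega
  intro x hx
  have hx' := hM.le_orthogonal_of_le hPQM hx
  rw [hsup] at hx'
  obtain ⟨a, ha, b, hb, rfl⟩ := Submodule.mem_sup.1 hx'
  by_cases haQ : a ∈ Q
  · exact Or.inr (Q.add_mem haQ hb)
  refine Or.inl (P.add_mem ha ?_)
  -- For singular `a`, `b`, the value `q (a + b)` is the polar form. Since `a` and `P ⊓ Q` span `P`,
  -- this makes `b` orthogonal to `P`, hence a member of `P`.
  have hab : polar q a b = 0 := by
    have := hM _ hx
    rwa [QuadraticMap.map_add q, hP a ha, hQ b hb, zero_add, zero_add] at this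
  have hspan : P ⊓ Q ⊔ Submodule.span K {a} = P := by
    refine Submodule.eq_of_le_of_finrank_le (sup_le inf_le_left
      ((Submodule.span_singleton_le_iff_mem _ _).2 ha)) ?_
    have h1 : P ⊓ Q < P ⊓ Q ⊔ Submodule.span K {a} := by
      refine lt_of_le_of_ne le_sup_left fun h => haQ ?_
      have : a ∈ P ⊓ Q := by
        rw [h]; exact Submodule.mem_sup_right (Submodule.mem_span_singleton_self a)
      exact this.2
    have := Submodule.finrank_lt_finrank_of_lt h1
    omega
  rw [← hP.orthogonal_eq hB hV hPn]
  intro y hy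
  rw [← hspan] at hy
  obtain ⟨c, hc, d, hd, rfl⟩ := Submodule.mem_sup.1 hy
  obtain ⟨t, rfl⟩ := Submodule.mem_span_singleton.1 hd
  change polar q (c + t • a) b = 0
  rw [polar_add_left, polar_smul_left, hab, hQ.polar_eq_zero hc.2 hb, smul_zero, add_zero]

/-- Two maximal totally singular subspaces that meet in codimension one belong to different
classes. -/
theorem IsTotallySingular.even_iff_not_even (hB : q.polarBilin.Nondegenerate)
    (hV : finrank K V = 2 * n) {P Q M : Submodule K V} (hP : IsTotallySingular q P)
    (hPn : finrank K P = n) (hQ : IsTotallySingular q Q) (hQn : finrank K Q = n)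
    (hPQ : finrank K (P ⊓ Q : Submodule K V) + 1 = n)
    (hM : IsTotallySingular q M) (hMn : finrank K M = n) :
    Even (finrank K P - finrank K (P ⊓ M : Submodule K V)) ↔
      ¬ Even (finrank K Q - finrank K (Q ⊓ M : Submodule K V)) := by
  -- The projection of `M` to the residue of `P ⊓ Q` is maximal and contains `P ⊓ Q`, so it is `P`
  -- or `Q`. Whichever it is meets `M` in exactly one dimension more than the other does.
  obtain ⟨h1, h2, h3⟩ := hM.projection hB hV hMn (hP.mono (inf_le_left (b := Q)))
  have key : ∀ {P Q : Submodule K V}, IsTotallySingular q P → IsTotallySingular q Q →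
      P ⊓ Q ⊔ M ⊓ polarOrthogonal q (P ⊓ Q) = P →
      finrank K (M ⊓ polarOrthogonal q (P ⊓ Q) : Submodule K V) =
        finrank K (M ⊓ (P ⊓ Q) : Submodule K V) + 1 →
      finrank K (P ⊓ M : Submodule K V) = finrank K (Q ⊓ M : Submodule K V) + 1 := by
    intro P Q hP hQ h h'
    have e1 : M ⊓ polarOrthogonal q (P ⊓ Q) = P ⊓ M :=
      le_antisymm (le_inf (le_sup_right.trans h.le) inf_le_left)
        (le_inf inf_le_right (inf_le_left.trans (hP.le_orthogonal_of_le inf_le_left)))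
    have e2 : M ⊓ (P ⊓ Q) = Q ⊓ M := by
      refine le_antisymm (le_inf (inf_le_right.trans inf_le_right) inf_le_left)
        (le_inf inf_le_right (le_inf (le_trans ?_ (e1.le.trans inf_le_left)) inf_le_left))
      exact le_inf inf_le_right (inf_le_left.trans (hQ.le_orthogonal_of_le inf_le_right))
    rw [← e1, h', e2]
  have hPM := Submodule.finrank_mono (inf_le_left : P ⊓ M ≤ P)
  have hQM := Submodule.finrank_mono (inf_le_left : Q ⊓ M ≤ Q)
  rw [Nat.even_sub hPM, Nat.even_sub hQM, hPn, hQn]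
  rcases hP.eq_or_eq hB hV hPn hQ hQn hPQ h2 h3 le_sup_left with h | h
  · rw [key hP hQ h (by omega), Nat.even_add_one]
    tauto
  · rw [inf_comm P Q] at h h1
    rw [key hQ hP h (by rw [inf_comm P Q] at hPQ; omega), Nat.even_add_one]
    tauto

end Quadratic

/-! ### Hyperbolic bases and rationality of maximal totally singular subspaces. -/

section Hyperbolic

open QuadraticMap Module

variable {K : Type u} {V : Type v} [Field K] [AddCommGroup V] [Module K V]
  {q : QuadraticForm K V} {n : ℕ} {E : Module.Basis (Fin n × Fin 2) K V} {K₀ : Subfield K}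

/-- `q` has the expression `x₁x₂ + ⋯ + x₂ₙ₋₁x₂ₙ` in the basis `E`. -/
def IsHyperbolicBasis (q : QuadraticForm K V) (E : Module.Basis (Fin n × Fin 2) K V) : Prop :=
  ∀ x : V, q x = ∑ i : Fin n, E.repr x (i, 0) * E.repr x (i, 1)

theorem IsHyperbolicBasis.polar_eq (hE : IsHyperbolicBasis q E) (x y : V) :
    polar q x y = ∑ i : Fin n,
      (E.repr x (i, 0) * E.repr y (i, 1) + E.repr x (i, 1) * E.repr y (i, 0)) := by
  rw [polar, hE, hE, hE, ← Finset.sum_sub_distrib, ← Finset.sum_sub_distrib]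
  refine Finset.sum_congr rfl fun i _ => ?_
  simp only [_root_.map_add, Finsupp.add_apply]
  ring

theorem IsHyperbolicBasis.polar_zero (hE : IsHyperbolicBasis q E) (x : V) (i : Fin n) :
    polar q x (E (i, 0)) = E.repr x (i, 1) := by
  rw [hE.polar_eq, Finset.sum_eq_single i] <;> simp +contextual

theorem IsHyperbolicBasis.polar_one (hE : IsHyperbolicBasis q E) (x : V) (i : Fin n) :
    polar q x (E (i, 1)) = E.repr x (i, 0) := by
  rw [hE.polar_eq, Finset.sum_eq_single i] <;> simp +contextual

theorem IsHyperbolicBasis.nondegenerate (hE : IsHyperbolicBasis q E) :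
    q.polarBilin.Nondegenerate := by
  have h : ∀ x, (∀ y, polar q x y = 0) → x = 0 := by
    intro x hx
    apply E.repr.injective
    ext ⟨i, e⟩
    rw [_root_.map_zero, Finsupp.zero_apply]
    fin_cases e
    · exact (hE.polar_one x i).symm.trans (hx _)
    · exact (hE.polar_zero x i).symm.trans (hx _)
  exact ⟨h, fun x hx => h x fun y => by rw [polar_comm]; exact hx y⟩

theorem finrank_eq_of_basis (E : Module.Basis (Fin n × Fin 2) K V) : finrank K V = 2 * n := by
  rw [finrank_eq_card_basis E]; simp [mul_comm]

theorem IsHyperbolicBasis.isTotallySingular_span (hE : IsHyperbolicBasis q E)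
    {s : Set (Fin n × Fin 2)} (hs : ∀ i, (i, 0) ∉ s ∨ (i, 1) ∉ s) :
    IsTotallySingular q (Submodule.span K (E '' s)) := by
  intro x hx
  rw [hE]
  refine Finset.sum_eq_zero fun i _ => ?_
  rcases hs i with h | h <;> rw [repr_eq_zero_of_mem_span_image E hx h] <;> simp

/-- Finitely many rational vectors span `R`. The polar form with each has coefficients in `K₀`, so
`R^⊥` is a finite intersection of rational kernels. -/
theorem IsHyperbolicBasis.isRational_orthogonal (hE : IsHyperbolicBasis q E) {R : Submodule K V}
    (hR : IsRational E K₀ R) : IsRational E K₀ (polarOrthogonal q R) := by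
  have : Module.Finite K V := Module.Finite.of_basis E
  obtain ⟨S, hS, rfl⟩ := hR
  obtain ⟨f, hf, hspan, -⟩ := Submodule.exists_fun_fin_finrank_span_eq K S
  have h : polarOrthogonal q (Submodule.span K S) =
      ⨅ j, LinearMap.ker (q.polarBilin (f j)) := by
    conv_lhs => rw [← hspan]
    ext x
    rw [Submodule.mem_iInf]
    refine ⟨fun hx j => hx _ (Submodule.subset_span ⟨j, rfl⟩), fun hx y hy => ?_⟩
    have : Submodule.span K (Set.range f) ≤ LinearMap.ker (q.polarBilin.flip x) := by
      rw [Submodule.span_le]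
      rintro _ ⟨j, rfl⟩
      exact hx j
    exact this hy
  rw [h]
  refine isRational_iInf fun j => isRational_ker ?_
  rintro ⟨i, e⟩
  rw [polarBilin_apply_apply]
  fin_cases e
  · change polar q (f j) (E (i, 0)) ∈ K₀
    rw [hE.polar_zero]; exact hS _ (hf j) _
  · change polar q (f j) (E (i, 1)) ∈ K₀
    rw [hE.polar_one]; exact hS _ (hf j) _

theorem IsHyperbolicBasis.polar_mem (hE : IsHyperbolicBasis q E) {x y : V}
    (hx : x ∈ rationalVectors E K₀) (hy : y ∈ rationalVectors E K₀) : polar q x y ∈ K₀ := by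
  rw [hE.polar_eq]
  exact sum_mem fun i _ => K₀.add_mem (K₀.mul_mem (hx _) (hy _)) (K₀.mul_mem (hx _) (hy _))

theorem IsHyperbolicBasis.apply_mem (hE : IsHyperbolicBasis q E) {x : V}
    (hx : x ∈ rationalVectors E K₀) : q x ∈ K₀ := by
  rw [hE]
  exact sum_mem fun i _ => K₀.mul_mem (hx _) (hx _)

/-- A maximal totally singular subspace is rational if it contains a rational subspace of
codimension at most one. -/
theorem IsHyperbolicBasis.isRational_of_le (hE : IsHyperbolicBasis q E) {P R : Submodule K V}
    (hP : IsTotallySingular q P) (hPn : finrank K P = n) (hR : IsRational E K₀ R) (hRP : R ≤ P)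
    (hRn : n ≤ finrank K R + 1) : IsRational E K₀ P := by
  have : Module.Finite K V := Module.Finite.of_basis E
  have hB := hE.nondegenerate
  have hV := finrank_eq_of_basis E
  have hle := Submodule.finrank_mono hRP
  rcases (show finrank K R = n ∨ finrank K R + 1 = n by omega) with hRn | hRn
  · rwa [← Submodule.eq_of_le_of_finrank_eq hRP (hRn.trans hPn.symm)]
  have hRs := hP.mono hRP
  -- Projecting a rational coordinate maximal subspace to the residue of `R` yields one rational
  -- maximal subspace `M` over `R`. A second one, `L`, is built below, and `P` must be one of the
  -- two.
  let N := Submodule.span K (E '' Set.range fun i : Fin n => (i, (0 : Fin 2)))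
  have hNr : IsRational E K₀ N :=
    isRational_span (by rintro _ ⟨i, -, rfl⟩; exact basis_mem_rationalVectors i)
  have hN : IsTotallySingular q N := hE.isTotallySingular_span fun i => Or.inr (by simp)
  have hNn : finrank K N = n := by
    rw [finrank_span_basis_image, ← Set.image_univ, Set.ncard_image_of_injective, Set.ncard_univ,
      Nat.card_fin]
    exact fun i j h => congrArg Prod.fst h
  obtain ⟨-, hM, hMn⟩ := hN.projection hB hV hNn hRs
  have hMr : IsRational E K₀ (R ⊔ N ⊓ polarOrthogonal q R) :=
    hR.sup (hNr.inf (hE.isRational_orthogonal hR))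
  have hRM : R ≤ R ⊔ N ⊓ polarOrthogonal q R := le_sup_left
  generalize R ⊔ N ⊓ polarOrthogonal q R = M at hM hMn hMr hRM
  obtain ⟨v, hv, hv0, hvM⟩ : ∃ v ∈ polarOrthogonal q R,
      v ∈ rationalVectors E K₀ ∧ v ∉ M := by
    by_contra! h
    have := Submodule.finrank_mono ((hE.isRational_orthogonal hR).le_of_forall h)
    rw [finrank_polarOrthogonal hB] at this
    omega
  obtain ⟨u, hu, hu0, huR⟩ : ∃ u ∈ M, u ∈ rationalVectors E K₀ ∧ u ∉ R := by
    by_contra! h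
    have := Submodule.finrank_mono (hMr.le_of_forall h)
    omega
  have hspan : ∀ {M : Submodule K V} {u : V}, finrank K M = n → R ≤ M → u ∈ M → u ∉ R →
      R ⊔ Submodule.span K {u} = M := by
    intro M u hMn hRM hu huR
    refine Submodule.eq_of_le_of_finrank_le (sup_le hRM
      ((Submodule.span_singleton_le_iff_mem _ _).2 hu)) ?_
    have h1 : R < R ⊔ Submodule.span K {u} := by
      refine lt_of_le_of_ne le_sup_left fun h => huR ?_
      rw [h]; exact Submodule.mem_sup_right (Submodule.mem_span_singleton_self u)
    have := Submodule.finrank_lt_finrank_of_lt h1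
    omega
  have huv : polar q u v ≠ 0 := by
    intro h0
    apply hvM
    rw [← hM.orthogonal_eq hB hV hMn]
    intro y hy
    rw [← hspan hMn hRM hu huR] at hy
    obtain ⟨c, hc, d, hd, rfl⟩ := Submodule.mem_sup.1 hy
    obtain ⟨t, rfl⟩ := Submodule.mem_span_singleton.1 hd
    have hcv : polar q c v = 0 := hv c hc
    change polar q (c + t • u) v = 0
    rw [polar_add_left, polar_smul_left, h0, hcv, smul_zero, add_zero]
  -- The scalar that makes `t • u + v` singular: as `u` is singular, `q (t • u + v) = t * polar q u
  -- v + q v`.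
  let t := -(q v * (polar q u v)⁻¹)
  have ht : t ∈ K₀ := K₀.neg_mem (K₀.mul_mem (hE.apply_mem hv0) (K₀.inv_mem (hE.polar_mem hu0 hv0)))
  have hw0 : t • u + v ∈ rationalVectors E K₀ :=
    add_mem ((rationalVectors E K₀).smul_mem ⟨t, ht⟩ hu0) hv0
  have hwM : t • u + v ∉ M := fun h =>
    hvM (by simpa using M.sub_mem h (M.smul_mem t hu))
  have hw : q (t • u + v) = 0 := by
    rw [QuadraticMap.map_add q, QuadraticMap.map_smul, hM u hu, polar_smul_left]
    simp [t, huv]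
  have hwR : t • u + v ∈ polarOrthogonal q R :=
    add_mem (Submodule.smul_mem _ _ (hM.le_orthogonal_of_le hRM hu)) hv
  have hLr : IsRational E K₀ (R ⊔ Submodule.span K {t • u + v}) :=
    hR.sup (isRational_span (by simpa using hw0))
  have hLs : IsTotallySingular q (R ⊔ Submodule.span K {t • u + v}) :=
    hRs.sup (isTotallySingular_span_singleton hw)
      ((Submodule.span_singleton_le_iff_mem _ _).2 hwR)
  have hRL : R ≤ R ⊔ Submodule.span K {t • u + v} := le_sup_left
  have hwL : t • u + v ∈ R ⊔ Submodule.span K {t • u + v} :=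
    Submodule.mem_sup_right (Submodule.mem_span_singleton_self _)
  have hLn : finrank K (R ⊔ Submodule.span K {t • u + v} : Submodule K V) = n := by
    have h1 := Submodule.finrank_lt_finrank_of_lt
      (lt_of_le_of_ne hRL fun h => hwM (hRM (by rw [h]; exact hwL)))
    have h2 := Submodule.finrank_add_le_finrank_add_finrank R (Submodule.span K {t • u + v})
    have h3 := finrank_span_le_card (R := K) ({t • u + v} : Set V)
    rw [Set.toFinset_singleton, Finset.card_singleton] at h3
    omega
  generalize R ⊔ Submodule.span K {t • u + v} = L at hLr hLs hRL hwL hLn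
  have hML : M ⊓ L = R := by
    refine (Submodule.eq_of_le_of_finrank_le (le_inf hRM hRL) ?_).symm
    have := Submodule.finrank_lt_finrank_of_lt
      (lt_of_le_of_ne (inf_le_right : M ⊓ L ≤ L) fun h =>
        hwM ((inf_le_left : M ⊓ L ≤ M) (by rw [h]; exact hwL)))
    omega
  rcases hM.eq_or_eq hB hV hMn hLs hLn (by rw [hML]; exact hRn) hP hPn (by rwa [hML]) with h | h
  · rwa [h]
  · rwa [h]

end Hyperbolic

/-! ### Incident maximal subspaces of opposite classes, and a chamber in general position. -/

section OppositeClasses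

open QuadraticMap Module

variable {K : Type u} {V : Type v} [Field K] [AddCommGroup V] [Module K V]
  {q : QuadraticForm K V} {n : ℕ} {E : Module.Basis (Fin n × Fin 2) K V} {K₀ : Subfield K}

/-- One of `P` and `Q` is rational, or `P ⊓ Q` contains a rational subspace of dimension
`n - 2`. -/
def RationalNear (E : Module.Basis (Fin n × Fin 2) K V) (K₀ : Subfield K) (P Q : Submodule K V) :
    Prop :=
  IsRational E K₀ P ∨ IsRational E K₀ Q ∨
    ∃ W, IsRational E K₀ W ∧ W ≤ P ⊓ Q ∧ finrank K W + 2 = n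

theorem RationalNear.symm {P Q : Submodule K V} (h : RationalNear E K₀ P Q) :
    RationalNear E K₀ Q P := by
  rcases h with h | h | ⟨W, h1, h2, h3⟩
  exacts [Or.inr (Or.inl h), Or.inl h, Or.inr (Or.inr ⟨W, h1, by rwa [inf_comm], h3⟩)]

/-- If `W` is orthogonal to `Q`, it lies in `Q^⊥ = Q`. Otherwise `Q ⊓ W^⊥` is a proper subspace of
`Q` containing the hyperplane `P ⊓ Q`, so the two agree. Then `P ⊓ Q` is rational, and so is `P`. -/
theorem IsHyperbolicBasis.isRational_or_le (hE : IsHyperbolicBasis q E) {P Q W : Submodule K V}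
    (hP : IsTotallySingular q P) (hPn : finrank K P = n) (hQ : IsTotallySingular q Q)
    (hQn : finrank K Q = n) (hPQ : finrank K (P ⊓ Q : Submodule K V) + 1 = n)
    (hQr : IsRational E K₀ Q) (hW : IsRational E K₀ W) (hWP : W ≤ P) :
    IsRational E K₀ P ∨ W ≤ Q := by
  have : Module.Finite K V := Module.Finite.of_basis E
  by_cases h : Q ≤ polarOrthogonal q W
  · right
    rw [← hQ.orthogonal_eq hE.nondegenerate (finrank_eq_of_basis E) hQn]
    intro x hx y hy
    exact (polar_comm q y x).trans (h hy x hx)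
  · left
    have h1 : P ⊓ Q ≤ Q ⊓ polarOrthogonal q W :=
      le_inf inf_le_right (inf_le_left.trans (hP.le_orthogonal_of_le hWP))
    have h2 := Submodule.finrank_lt_finrank_of_lt
      (lt_of_le_of_ne (inf_le_left : Q ⊓ polarOrthogonal q W ≤ Q) fun h' => h (inf_eq_left.1 h'))
    have h3 := Submodule.eq_of_le_of_finrank_le h1 (by omega)
    refine hE.isRational_of_le hP hPn (R := P ⊓ Q) ?_ inf_le_left (by omega)
    rw [h3]
    exact hQr.inf (hE.isRational_orthogonal hW)

/-- Both outcomes persist along the line on which `Q` moves: `P` is fixed, and `A` lies in all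
positions. In the main case, two rational subspaces `W`, `W'` of dimension `n - 2` in `P` either
coincide, and then equal `A`, or span at least a hyperplane of `P`. -/
theorem IsHyperbolicBasis.isRational_or_of_rationalNear (hE : IsHyperbolicBasis q E)
    {P Q Q' A : Submodule K V} (hP : IsTotallySingular q P) (hPn : finrank K P = n)
    (hQ : IsTotallySingular q Q) (hQn : finrank K Q = n)
    (hQ' : IsTotallySingular q Q') (hQn' : finrank K Q' = n)
    (hPQ : finrank K (P ⊓ Q : Submodule K V) + 1 = n)
    (hPQ' : finrank K (P ⊓ Q' : Submodule K V) + 1 = n)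
    (hA : Q ⊓ Q' = A) (hAn : finrank K A + 2 = n)
    (h : RationalNear E K₀ P Q) (h' : RationalNear E K₀ P Q') :
    IsRational E K₀ P ∨ IsRational E K₀ A := by
  have : Module.Finite K V := Module.Finite.of_basis E
  have key : ∀ W, IsRational E K₀ W → W ≤ Q → W ≤ Q' → finrank K W + 2 = n →
      IsRational E K₀ A := by
    intro W hW h1 h2 h3
    rwa [← Submodule.eq_of_le_of_finrank_eq ((le_inf h1 h2).trans hA.le) (by omega)]
  rcases h with h | h | ⟨W, hW, hWPQ, hWn⟩
  · exact Or.inl h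
  · rcases h' with h' | h' | ⟨W', hW', hWPQ', hWn'⟩
    · exact Or.inl h'
    · exact Or.inr (hA ▸ h.inf h')
    · exact (hE.isRational_or_le hP hPn hQ hQn hPQ h hW' (hWPQ'.trans inf_le_left)).imp_right
        fun hle => key W' hW' hle (hWPQ'.trans inf_le_right) hWn'
  · rcases h' with h' | h' | ⟨W', hW', hWPQ', hWn'⟩
    · exact Or.inl h'
    · exact (hE.isRational_or_le hP hPn hQ' hQn' hPQ' h' hW (hWPQ.trans inf_le_left)).imp_right
        fun hle => key W hW (hWPQ.trans inf_le_right) hle hWn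
    · by_cases hWW : W = W'
      · exact Or.inr (key W hW (hWPQ.trans inf_le_right)
          (by rw [hWW]; exact hWPQ'.trans inf_le_right) hWn)
      · left
        refine hE.isRational_of_le hP hPn (hW.sup hW')
          (sup_le (hWPQ.trans inf_le_left) (hWPQ'.trans inf_le_left)) ?_
        have := Submodule.finrank_lt_finrank_of_lt
          (lt_of_le_of_ne (le_sup_left : W ≤ W ⊔ W') fun h => hWW
            (Submodule.eq_of_le_of_finrank_eq (by rw [h]; exact le_sup_right) (by omega)).symm)
        omega

/-- Subspaces forming a chamber of `D_n` that is in general position with respect to `K₀`. -/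
theorem IsHyperbolicBasis.exists_chamber_subspaces (hE : IsHyperbolicBasis q E) (hn : 3 ≤ n)
    (hK : K₀ ≠ ⊤) :
    ∃ (X : ℕ → Submodule K V) (Y : Fin 2 → Submodule K V), Monotone X ∧
      (∀ m ≤ n - 2, finrank K (X m) = m) ∧ (∀ m ≤ n - 2, ∀ e, X m ≤ Y e) ∧
      (∀ e, IsTotallySingular q (Y e)) ∧ (∀ e, finrank K (Y e) = n) ∧
      finrank K (Y 0 ⊓ Y 1 : Submodule K V) + 1 = n ∧
      (∀ m e, 1 ≤ m → ¬ RationalBetween E K₀ (X m) (Y e)) ∧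
      (∀ W, IsRational E K₀ W → W ≤ Y 0 ⊓ Y 1 → finrank K W + 2 ≠ n) := by
  have : Module.Finite K V := Module.Finite.of_basis E
  obtain ⟨α, hα⟩ : ∃ α, α ∉ K₀ := by
    by_contra! h
    exact hK (SetLike.ext fun x => by simp [h x])
  let i₀ : Fin n := ⟨0, by omega⟩
  let i₁ : Fin n := ⟨1, by omega⟩
  have hi : i₀ ≠ i₁ := by simp [i₀, i₁]
  -- `1 + N` sends `E (i₀, 0)` to `E (i₀, 0) + α • E (i₁, 0)`; the second term, sending `E (i₁, 1)`
  -- to `E (i₁, 1) - α • E (i₀, 1)`, is what makes it an isometry.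
  let N : V →ₗ[K] V :=
    (LinearMap.toSpanSingleton K V (α • E (i₁, 0))).comp (E.coord (i₀, 0)) -
      (LinearMap.toSpanSingleton K V (α • E (i₀, 1))).comp (E.coord (i₁, 1))
  have hNa : ∀ x, N x = (E.repr x (i₀, 0) * α) • E (i₁, 0) -
      (E.repr x (i₁, 1) * α) • E (i₀, 1) := fun x => by simp [N, mul_smul]
  have hN0 : ∀ x i, E.repr (N x) (i, 0) = if i = i₁ then E.repr x (i₀, 0) * α else 0 := by
    intro x i
    rw [hNa]
    by_cases h : i = i₁
    · subst h; simp
    · simp [h]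
  have hN1 : ∀ x i, E.repr (N x) (i, 1) = if i = i₀ then - (E.repr x (i₁, 1) * α) else 0 := by
    intro x i
    rw [hNa]
    by_cases h : i = i₀
    · subst h; simp
    · simp [h]
  have hN : ∀ x, N (N x) = 0 := fun x => by
    rw [hNa, hN0, hN1, if_neg hi, if_neg hi.symm]; simp
  let E' := unipotentBasis E N hN
  have hE0 : ∀ x i, E'.repr x (i, 0) =
      E.repr x (i, 0) - if i = i₁ then E.repr x (i₀, 0) * α else 0 := fun x i => by
    rw [unipotentBasis_repr, hN0]
  have hE1 : ∀ x i, E'.repr x (i, 1) =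
      E.repr x (i, 1) - if i = i₀ then - (E.repr x (i₁, 1) * α) else 0 := fun x i => by
    rw [unipotentBasis_repr, hN1]
  have hE' : IsHyperbolicBasis q E' := by
    intro x
    have : ∀ i, E'.repr x (i, 0) * E'.repr x (i, 1) = E.repr x (i, 0) * E.repr x (i, 1) +
        ((if i = i₀ then E.repr x (i₀, 0) * E.repr x (i₁, 1) * α else 0) -
          (if i = i₁ then E.repr x (i₀, 0) * E.repr x (i₁, 1) * α else 0)) := by
      intro i
      rw [hE0, hE1]
      by_cases h0 : i = i₀
      · subst h0
        simp only [if_true, if_neg hi]; ring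
      · by_cases h1 : i = i₁
        · subst h1
          simp only [if_true, if_neg hi.symm]; ring
        · simp only [if_neg h0, if_neg h1]; ring
    rw [hE x, Finset.sum_congr rfl fun i _ => this i, Finset.sum_add_distrib,
      Finset.sum_sub_distrib]
    simp
  -- One index from each hyperbolic pair, in the order `(0,0), (2,0), …, (n-2,0), (1,1), (n-1,e)`.
  -- Only the last depends on `e`, so the two maximal subspaces share a hyperplane. Leaving out
  -- `(i₁, 0)` and `(i₀, 1)` gives the two relations with coefficients `α` and `-α`.
  let g : Fin 2 → Fin n → Fin n × Fin 2 := fun e k =>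
    if h0 : k.val = 0 then (i₀, 0) else if h : k.val < n - 2 then (⟨k + 1, by omega⟩, 0)
    else if k.val = n - 2 then (i₁, 1) else (⟨n - 1, by omega⟩, e)
  have hg : ∀ e, Function.Injective (g e) := by
    intro e j k h
    ext
    dsimp only [g] at h
    split_ifs at h <;> simp [i₀, i₁] at h <;> omega
  have hg01 : ∀ e (k : Fin n), k.val < n - 1 → g e k = g 0 k := by
    intro e k hk
    dsimp only [g]
    split_ifs <;> first | rfl | omega
  have hgs : ∀ e i, (i, 0) ∉ Set.range (g e) ∨ (i, 1) ∉ Set.range (g e) := by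
    intro e i
    by_contra! h
    obtain ⟨⟨j, hj⟩, k, hk⟩ := h
    dsimp only [g] at hj hk
    split_ifs at hj hk <;>
      simp only [Prod.mk.injEq, Fin.ext_iff, Fin.coe_ofNat_eq_mod, i₀, i₁] at hj hk <;>
      omega
  have hg10 : ∀ e, (i₁, 0) ∉ Set.range (g e) := by
    rintro e ⟨j, hj⟩
    dsimp only [g] at hj
    split_ifs at hj <;> simp only [Prod.mk.injEq, Fin.ext_iff, Fin.coe_ofNat_eq_mod, i₀, i₁] at hj <;> omega
  have hg00 : ∀ e, g e i₀ = (i₀, 0) := fun e => dif_pos rfl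
  have hg11 : ∀ e, g e ⟨n - 2, by omega⟩ = (i₁, 1) := fun e => by
    dsimp only [g]
    rw [dif_neg (by omega), dif_neg (by omega), if_pos rfl]
  have hgl : ∀ e, g e ⟨n - 1, by omega⟩ = (⟨n - 1, by omega⟩, e) := fun e => by
    dsimp only [g]
    split_ifs <;> first | rfl | omega
  have hg01' : (i₀, 1) ∉ Set.range (g 0) := fun h =>
    (hgs 0 i₀).elim (fun h' => h' ⟨i₀, hg00 0⟩) (fun h' => h' h)
  have hcard : ∀ (e : Fin 2) (s : Finset (Fin n)),
      finrank K (Submodule.span K (E' '' (g e '' s))) = s.card := by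
    intro e s
    rw [finrank_span_basis_image, Set.ncard_image_of_injective _ (hg e), Set.ncard_coe_finset]
  let s : ℕ → Finset (Fin n) := fun m => Finset.univ.filter fun k => k.val < m
  have hs : ∀ m ≤ n, (s m).card = m := fun m hm => by
    rw [Fin.card_filter_val_lt]; exact min_eq_right hm
  have hsr : ∀ e m, E' '' (g e '' s m) ⊆ E' '' Set.range (g e) := fun e m =>
    Set.image_mono (Set.image_subset_range _ _)
  have hs01 : ∀ e m, m ≤ n - 1 → g e '' s m = g 0 '' s m := fun e m hm =>
    Set.image_congr fun k hk => hg01 e k (by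
      have : k.val < m := by simpa [s] using hk
      omega)
  let X : ℕ → Submodule K V := fun m => Submodule.span K (E' '' (g 0 '' s m))
  let Y : Fin 2 → Submodule K V := fun e => Submodule.span K (E' '' Set.range (g e))
  have hYn : ∀ e, finrank K (Y e) = n := fun e => by
    have := hcard e Finset.univ
    rwa [Finset.coe_univ, Set.image_univ, Finset.card_univ, Fintype.card_fin] at this
  have hXY : ∀ m ≤ n - 1, ∀ e, X m ≤ Y e := fun m hm e => by
    refine Submodule.span_mono ?_
    rw [← hs01 e m hm]
    exact hsr e m
  have hlast : ∀ x ∈ Y 1, E'.repr x (⟨n - 1, by omega⟩, 0) = 0 := fun x hx =>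
    repr_eq_zero_of_mem_span_image E' hx fun h =>
      (hgs 1 _).elim (fun h' => h' h) (fun h' => h' ⟨_, hgl 1⟩)
  have hYrel : ∀ e, ∀ x ∈ Y e, E.repr x (i₁, 0) = E.repr x (i₀, 0) * α := fun e x hx => by
    have := repr_eq_zero_of_mem_span_image E' hx (hg10 e)
    rwa [hE0, if_pos rfl, sub_eq_zero] at this
  have hYrel' : ∀ x ∈ Y 0, E.repr x (i₀, 1) = E.repr x (i₁, 1) * (-α) := fun x hx => by
    have := repr_eq_zero_of_mem_span_image E' hx hg01'
    rw [hE1, if_pos rfl, sub_eq_zero] at this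
    rw [this, mul_neg]
  refine ⟨X, Y, fun m m' h => Submodule.span_mono (Set.image_mono (Set.image_mono ?_)),
    fun m hm => (hcard 0 _).trans (hs m (by omega)), fun m hm => hXY m (by omega),
    fun e => hE'.isTotallySingular_span (hgs e), hYn, ?_, ?_, ?_⟩
  · intro k hk
    simp only [s, Finset.coe_filter, Finset.mem_univ, true_and, Set.mem_ofPred_eq] at hk ⊢
    omega
  · have h1 := Submodule.finrank_mono (le_inf (hXY (n - 1) le_rfl 0) (hXY (n - 1) le_rfl 1))
    have h2 : finrank K (X (n - 1)) = n - 1 := (hcard 0 _).trans (hs _ (by omega))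
    have h3 := Submodule.finrank_lt_finrank_of_lt
      (lt_of_le_of_ne (inf_le_left : Y 0 ⊓ Y 1 ≤ Y 0) fun h => by
        have hmem : E' (⟨n - 1, by omega⟩, 0) ∈ Y 0 :=
          Submodule.subset_span ⟨_, ⟨_, hgl 0⟩, rfl⟩
        rw [← h] at hmem
        have := hlast _ hmem.2
        simp at this)
    have h4 := hYn 0
    omega
  · intro m e hm
    refine not_rationalBetween hα (hYrel e) (p := E' (i₀, 0)) ?_ ?_
    · exact Submodule.subset_span ⟨_, ⟨i₀, by simp [s, i₀]; omega, hg00 0⟩, rfl⟩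
    · have := hE0 (E' (i₀, 0)) i₀
      rw [if_neg hi, sub_zero] at this
      rw [← this]; simp
  · intro W hW hWY hWn
    -- Rationality kills the coordinates at `(i₀, 0)` and `(i₁, 1)`, leaving only `n - 3` of the `n
    -- - 1` basis vectors of `Y 0 ⊓ Y 1`.
    have h0 := hW.repr_eq_zero hα (fun x hx => hYrel 0 x (hWY hx).1)
    have h1 := hW.repr_eq_zero (α := -α) (fun h => hα (by simpa using K₀.neg_mem h))
      (fun x hx => hYrel' x (hWY hx).1)
    let t : Finset (Fin n) := (s (n - 2)).erase i₀
    have ht : t.card = n - 3 := by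
      rw [Finset.card_erase_of_mem (by simp [s, i₀]; omega), hs _ (by omega)]; omega
    have hle : W ≤ Submodule.span K (E' '' (g 0 '' t)) := by
      intro x hx
      refine mem_span_basis_image E' fun i hi' => ?_
      by_cases hir : i ∈ Set.range (g 0)
      · obtain ⟨k, rfl⟩ := hir
        by_cases hk0 : k = i₀
        · rw [hk0, hg00, hE0, if_neg hi, sub_zero]
          exact h0 x hx
        by_cases hk1 : k = ⟨n - 2, by omega⟩
        · rw [hk1, hg11, hE1, if_neg hi.symm, sub_zero]
          exact h1 x hx
        by_cases hk2 : k = ⟨n - 1, by omega⟩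
        · rw [hk2, hgl]
          exact hlast x (hWY hx).2
        · refine absurd ⟨k, ?_, rfl⟩ hi'
          simp only [Fin.ext_iff] at hk1 hk2
          have := k.2
          simp only [t, s, Finset.coe_erase, Finset.coe_filter, Finset.mem_univ, true_and,
            Set.mem_sdiff, Set.mem_ofPred_eq, Set.mem_singleton_iff]
          exact ⟨by omega, hk0⟩
      · exact repr_eq_zero_of_mem_span_image E' (hWY hx).1 hir
    have := Submodule.finrank_mono hle
    rw [hcard, ht] at this
    omega

end OppositeClasses

/-! ### The case of type `D_n`. -/

section TypeD

open QuadraticMap Module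

variable {K : Type u} {V : Type v} [Field K] [AddCommGroup V] [Module K V]
  {q : QuadraticForm K V} {n : ℕ} {E : Module.Basis (Fin n × Fin 2) K V} {K₀ : Subfield K}
  {M₀ : Submodule K V}

theorem geometryD_typ_of_finrank_eq {x : (geometryD n q M₀).Elem} (h : finrank K x.1 = n) :
    (geometryD n q M₀).typ x = .plus ∧
        Even (finrank K x.1 - finrank K (x.1 ⊓ M₀ : Submodule K V)) ∨
      (geometryD n q M₀).typ x = .minus ∧
        ¬ Even (finrank K x.1 - finrank K (x.1 ⊓ M₀ : Submodule K V)) := by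
  change typeD M₀ x = .plus ∧ _ ∨ typeD M₀ x = .minus ∧ _
  unfold typeD
  split_ifs with h1
  · exact Or.inl ⟨rfl, h1⟩
  · exact Or.inr ⟨rfl, h1⟩

theorem geometryD_finrank_low {x : (geometryD n q M₀).Elem} {i : Fin (n - 2)}
    (h : (geometryD n q M₀).typ x = .low i) : finrank K x.1 = i + 1 := by
  change typeD M₀ x = .low i at h
  have := x.2.2.1
  unfold typeD at h
  split_ifs at h
  have := congrArg Fin.val (NodeD.low.inj h)
  simp only at this
  omega

theorem geometryD_finrank_max {x : (geometryD n q M₀).Elem}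
    (h : (geometryD n q M₀).typ x = .plus ∨ (geometryD n q M₀).typ x = .minus) :
    finrank K x.1 = n := by
  change typeD M₀ x = .plus ∨ typeD M₀ x = .minus at h
  by_contra hne
  simp [typeD, hne] at h

theorem geometryD_typ_low {x : (geometryD n q M₀).Elem} {i : Fin (n - 2)}
    (h : finrank K x.1 = i + 1) : (geometryD n q M₀).typ x = .low i := by
  change typeD M₀ x = .low i
  have := i.2
  unfold typeD
  rw [dif_neg (by omega)]
  simp [h]

theorem geometryD_le_of_inc [FiniteDimensional K V] {x y : (geometryD n q M₀).Elem}
    (h : (geometryD n q M₀).Inc x y) (hxy : finrank K x.1 < finrank K y.1) : x.1 ≤ y.1 := by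
  rcases h with (h | h) | ⟨h, -⟩
  · exact h
  · exact absurd (Submodule.finrank_mono h) (by omega)
  · have hx : finrank K x.1 = n := geometryD_finrank_max (h.imp And.left And.left)
    have hy : finrank K y.1 = n := geometryD_finrank_max (h.symm.imp And.right And.right)
    omega

theorem geometryD_finrank_inf {x y : (geometryD n q M₀).Elem} (hn : 3 ≤ n)
    (h : (geometryD n q M₀).Inc x y) (hx : finrank K x.1 = n) (hy : finrank K y.1 = n)
    (hxy : (geometryD n q M₀).typ x ≠ (geometryD n q M₀).typ y) :
    finrank K (x.1 ⊓ y.1 : Submodule K V) + 1 = n := by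
  have : FiniteDimensional K x.1 := FiniteDimensional.of_finrank_pos (by omega)
  have : FiniteDimensional K y.1 := FiniteDimensional.of_finrank_pos (by omega)
  rcases h with (h | h) | ⟨-, h⟩
  · exact absurd (congrArg _ (Subtype.ext (Submodule.eq_of_le_of_finrank_eq h (hx.trans hy.symm))))
      hxy
  · exact absurd (congrArg _ (Subtype.ext (Submodule.eq_of_le_of_finrank_eq h (hy.trans hx.symm))))
      hxy.symm
  · omega

/-- Two distinct elements of the same class through `A`, of dimension `n - 2`, meet in `A`. -/
theorem geometryD_inf_eq [FiniteDimensional K V] (hB : q.polarBilin.Nondegenerate)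
    (hV : finrank K V = 2 * n) (hM₀ : IsTotallySingular q M₀) (hM₀n : finrank K M₀ = n)
    {y y' : (geometryD n q M₀).Elem} (hy : finrank K y.1 = n)
    (ht : (geometryD n q M₀).typ y = (geometryD n q M₀).typ y') (hne : y ≠ y')
    {A : Submodule K V} (hA : A ≤ y.1) (hA' : A ≤ y'.1) (hAn : finrank K A + 2 = n) :
    y.1 ⊓ y'.1 = A := by
  have hy' : finrank K y'.1 = n := by rw [← finrank_eq_of_typeD_eq M₀ y y' ht, hy]
  -- Meeting in codimension one would put the two in different classes.
  have h1 : finrank K (y.1 ⊓ y'.1 : Submodule K V) + 1 ≠ n := by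
    intro h
    have h2 := y.2.1.even_iff_not_even hB hV hy y'.2.1 hy' h hM₀ hM₀n
    rcases geometryD_typ_of_finrank_eq (M₀ := M₀) hy with h3 | h3 <;>
      rcases geometryD_typ_of_finrank_eq (M₀ := M₀) hy' with h4 | h4
    · exact h2.1 h3.2 h4.2
    · rw [h3.1, h4.1] at ht; cases ht
    · rw [h3.1, h4.1] at ht; cases ht
    · exact h3.2 (h2.2 h4.2)
  have h2 := Submodule.finrank_lt_finrank_of_lt
    (lt_of_le_of_ne (inf_le_left : y.1 ⊓ y'.1 ≤ y.1) fun h =>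
      hne (Subtype.ext (Submodule.eq_of_le_of_finrank_eq (inf_eq_left.1 h) (hy.trans hy'.symm))))
  exact (Submodule.eq_of_le_of_finrank_le (le_inf hA hA') (by omega)).symm

theorem closedAt_left_typeD (E : Module.Basis (Fin n × Fin 2) K V) {i : Fin (n - 2)}
    {k : NodeD n} : (geometryD n q M₀).ClosedAt (diagramD n) (.low i) k
      (fun x y => RationalBetween E K₀ x.1 y.1) := by
  have : Module.Finite K V := Module.Finite.of_basis E
  intro x x' x'' y hx hx' hx'' hy hne hxy hxy' hxy'' hadj hG hG'
  have hi := i.2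
  have hx := geometryD_finrank_low hx
  have hx' := geometryD_finrank_low hx'
  have hx'' := geometryD_finrank_low hx''
  have hne' : x.1 ≠ x'.1 := fun h => hne (Subtype.ext h)
  refine hG.sup hG' ?_
  -- At the branch node no element has dimension `n - 1`. The intersection of the elements of types
  -- `+` and `-` on the line takes its place, having dimension at most `n - 1`.
  by_cases hi' : i.val + 1 = n - 2
  · obtain ⟨b, hb, h, h', h'', -⟩ := hadj .plus hi'
    obtain ⟨c, hc, k, k', k'', -⟩ := hadj .minus hi'
    have hbn : finrank K b.1 = n := geometryD_finrank_max (Or.inl hb)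
    have hcn : finrank K c.1 = n := geometryD_finrank_max (Or.inr hc)
    have hbc := Submodule.finrank_lt_finrank_of_lt
      (lt_of_le_of_ne (inf_le_left : b.1 ⊓ c.1 ≤ b.1) fun h => by
        have : b = c :=
          Subtype.ext (Submodule.eq_of_le_of_finrank_eq (inf_eq_left.1 h) (hbn.trans hcn.symm))
        rw [this, hc] at hb
        cases hb)
    exact (le_inf (geometryD_le_of_inc h'' (by omega)) (geometryD_le_of_inc k'' (by omega))).trans
      (Submodule.le_sup_of_finrank_eq_succ
        (le_inf (geometryD_le_of_inc h (by omega)) (geometryD_le_of_inc k (by omega)))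
        (le_inf (geometryD_le_of_inc h' (by omega)) (geometryD_le_of_inc k' (by omega)))
        (by omega) (by omega) hne')
  · obtain ⟨b, hb, h, h', h'', -⟩ := hadj (.low ⟨i + 1, by omega⟩) (Or.inl rfl)
    have hb := geometryD_finrank_low hb
    simp only at hb
    exact (geometryD_le_of_inc h'' (by omega)).trans
      (Submodule.le_sup_of_finrank_eq_succ (geometryD_le_of_inc h (by omega))
        (geometryD_le_of_inc h' (by omega)) (by omega) (by omega) hne')

theorem closedAt_low_right_typeD (E : Module.Basis (Fin n × Fin 2) K V) {i k : Fin (n - 2)}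
    (hik : i < k) :
    (geometryD n q M₀).ClosedAt (diagramD n) (.low k) (.low i)
      (fun y x => RationalBetween E K₀ x.1 y.1) := by
  have : Module.Finite K V := Module.Finite.of_basis E
  intro x x' x'' y hx hx' hx'' hy hne _ _ _ hadj hG hG'
  have hik' : i.val < k.val := hik
  have hk := k.2
  obtain ⟨b, hb, h, h', h'', -⟩ := hadj (.low ⟨k - 1, by omega⟩)
    (Or.inr (by simp only; omega))
  have hx := geometryD_finrank_low hx
  have hx' := geometryD_finrank_low hx'
  have hx'' := geometryD_finrank_low hx''
  have hb := geometryD_finrank_low hb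
  simp only at hb
  have hi := (geometryD n q M₀).inc_symm
  exact hG.inf hG' ((Submodule.inf_le_of_finrank_eq_succ
      (geometryD_le_of_inc (hi _ _ h) (by omega))
      (geometryD_le_of_inc (hi _ _ h') (by omega)) (by omega) (by omega)
      fun h => hne (Subtype.ext h)).trans (geometryD_le_of_inc (hi _ _ h'') (by omega)))

/-- When a maximal element moves along a line, it contains a fixed subspace of dimension `n - 2`,
which is the intersection of any two of its positions. -/
theorem IsHyperbolicBasis.exists_inf_eq (hE : IsHyperbolicBasis q E) (hn : 3 ≤ n)
    (hM₀ : IsTotallySingular q M₀) (hM₀n : finrank K M₀ = n)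
    {k : NodeD n} (hk : k = .plus ∨ k = .minus) {x x' x'' y : (geometryD n q M₀).Elem}
    (hx : (geometryD n q M₀).typ x = k) (hx' : (geometryD n q M₀).typ x' = k)
    (hx'' : (geometryD n q M₀).typ x'' = k) (hne : x ≠ x')
    (hadj : ∀ a, (diagramD n).Adj k a → ∃ b, (geometryD n q M₀).typ b = a ∧
      (geometryD n q M₀).Inc x b ∧ (geometryD n q M₀).Inc x' b ∧ (geometryD n q M₀).Inc x'' b ∧
      (geometryD n q M₀).Inc y b) :
    x.1 ⊓ x'.1 ≤ x''.1 ∧ finrank K (x.1 ⊓ x'.1 : Submodule K V) + 2 = n ∧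
      (finrank K y.1 = n → x.1 ⊓ x'.1 ≤ y.1) := by
  have : Module.Finite K V := Module.Finite.of_basis E
  -- The index `n - 3` is the node of type `n - 2`, the only neighbour of `+` and of `-`.
  obtain ⟨b, hb, h, h', h'', hy⟩ := hadj (.low ⟨n - 3, by omega⟩) (by
    have : n - 3 + 1 = n - 2 := by omega
    rcases hk with rfl | rfl <;> exact this)
  have hb := geometryD_finrank_low hb
  simp only at hb
  have hxn : finrank K x.1 = n := geometryD_finrank_max (hx ▸ hk)
  have hxn' : finrank K x'.1 = n := geometryD_finrank_max (hx' ▸ hk)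
  have hxn'' : finrank K x''.1 = n := geometryD_finrank_max (hx'' ▸ hk)
  have hi := (geometryD n q M₀).inc_symm
  rw [geometryD_inf_eq hE.nondegenerate (finrank_eq_of_basis E) hM₀ hM₀n hxn (hx.trans hx'.symm)
    hne (geometryD_le_of_inc (hi _ _ h) (by omega)) (geometryD_le_of_inc (hi _ _ h') (by omega))
    (by omega)]
  exact ⟨geometryD_le_of_inc (hi _ _ h'') (by omega), by omega, fun hyn =>
    geometryD_le_of_inc (hi _ _ hy) (by omega)⟩

theorem IsHyperbolicBasis.closedAt_max_right (hE : IsHyperbolicBasis q E) (hn : 3 ≤ n)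
    (hM₀ : IsTotallySingular q M₀) (hM₀n : finrank K M₀ = n)
    {k i : NodeD n} (hk : k = .plus ∨ k = .minus) :
    (geometryD n q M₀).ClosedAt (diagramD n) k i
      (fun y x => RationalBetween E K₀ x.1 y.1) :=
  fun _ _ _ _ hx hx' hx'' _ hne _ _ _ hadj hG hG' =>
    hG.inf hG' (hE.exists_inf_eq hn hM₀ hM₀n hk hx hx' hx'' hne hadj).1

/-- Two positions of the moving element meet in a subspace of dimension `n - 2` lying in the third
position and in the fixed element. Either this subspace or the fixed element is rational, and each
suffices for `RationalNear`. -/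
theorem IsHyperbolicBasis.closedAt_max_max (hE : IsHyperbolicBasis q E) (hn : 3 ≤ n)
    (hM₀ : IsTotallySingular q M₀) (hM₀n : finrank K M₀ = n)
    {k i : NodeD n} (hk : k = .plus ∨ k = .minus) (hi : i = .plus ∨ i = .minus) (hik : i ≠ k) :
    (geometryD n q M₀).ClosedAt (diagramD n) k i
      (fun x y => RationalNear E K₀ x.1 y.1) := by
  intro x x' x'' y hx hx' hx'' hy hne h h' h'' hadj hG hG'
  obtain ⟨h1, h2, h3⟩ := hE.exists_inf_eq hn hM₀ hM₀n hk hx hx' hx'' hne hadj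
  have hxn : finrank K x.1 = n := geometryD_finrank_max (hx ▸ hk)
  have hxn' : finrank K x'.1 = n := geometryD_finrank_max (hx' ▸ hk)
  have hyn : finrank K y.1 = n := geometryD_finrank_max (hy ▸ hi)
  have hinf : ∀ x : (geometryD n q M₀).Elem, (geometryD n q M₀).typ x = k →
      (geometryD n q M₀).Inc x y → finrank K (y.1 ⊓ x.1 : Submodule K V) + 1 = n :=
    fun x hx h => geometryD_finrank_inf hn ((geometryD n q M₀).inc_symm _ _ h) hyn
      (geometryD_finrank_max (hx ▸ hk)) (by rw [hx, hy]; exact hik)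
  rcases hE.isRational_or_of_rationalNear y.2.1 hyn x.2.1 hxn x'.2.1 hxn' (hinf x hx h)
    (hinf x' hx' h') rfl h2 hG.symm hG'.symm with h4 | h4
  · exact Or.inr (Or.inl h4)
  · exact Or.inr (Or.inr ⟨_, h4, le_inf h1 (h3 hyn), h2⟩)

/-- A chamber of `D_n` in general position with respect to `K₀`. -/
theorem IsHyperbolicBasis.exists_chamber (hE : IsHyperbolicBasis q E) (hn : 3 ≤ n)
    (hK : K₀ ≠ ⊤) (hM₀ : IsTotallySingular q M₀) (hM₀n : finrank K M₀ = n) :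
    ∃ C : Set (geometryD n q M₀).Elem, (geometryD n q M₀).IsFlagOfType Set.univ C ∧
      (∀ x ∈ C, ∀ y ∈ C, ∀ i, (geometryD n q M₀).typ x = .low i →
        finrank K x.1 < finrank K y.1 → ¬ RationalBetween E K₀ x.1 y.1) ∧
      (∀ x ∈ C, ∀ y ∈ C, finrank K x.1 = n → finrank K y.1 = n →
        (geometryD n q M₀).typ x ≠ (geometryD n q M₀).typ y → ¬ RationalNear E K₀ x.1 y.1) := by
  have : Module.Finite K V := Module.Finite.of_basis E
  obtain ⟨X, Y, hmono, hX, hXY, hYs, hY, hYY, hrat, hW⟩ :=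
    hE.exists_chamber_subspaces hn hK
  let cY : Fin 2 → (geometryD n q M₀).Elem := fun e =>
    ⟨Y e, hYs e, by rw [hY]; omega, Or.inr (hY e)⟩
  let cX : Fin (n - 2) → (geometryD n q M₀).Elem := fun i =>
    ⟨X (i + 1), (hYs 0).mono (hXY _ (by omega) 0), by rw [hX _ (by omega)]; omega,
      Or.inl (by rw [hX _ (by omega)]; omega)⟩
  have hcX : ∀ i, (geometryD n q M₀).typ (cX i) = .low i := fun i =>
    geometryD_typ_low (hX _ (by omega))
  have hcYmax : ∀ e, (geometryD n q M₀).typ (cY e) = .plus ∨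
      (geometryD n q M₀).typ (cY e) = .minus := fun e =>
    (geometryD_typ_of_finrank_eq (x := cY e) (hY e)).imp And.left And.left
  have hcY : (geometryD n q M₀).typ (cY 0) = .plus ∧ (geometryD n q M₀).typ (cY 1) = .minus ∨
      (geometryD n q M₀).typ (cY 0) = .minus ∧ (geometryD n q M₀).typ (cY 1) = .plus := by
    have h := (hYs 0).even_iff_not_even hE.nondegenerate (finrank_eq_of_basis E) (hY 0) (hYs 1)
      (hY 1) hYY hM₀ hM₀n
    rcases geometryD_typ_of_finrank_eq (x := cY 0) (hY 0) with h0 | h0 <;>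
      rcases geometryD_typ_of_finrank_eq (x := cY 1) (hY 1) with h1 | h1
    · exact absurd h1.2 (h.1 h0.2)
    · exact Or.inl ⟨h0.1, h1.1⟩
    · exact Or.inr ⟨h0.1, h1.1⟩
    · exact absurd (h.2 h1.2) h0.2
  have hinc : (geometryD n q M₀).Inc (cY 0) (cY 1) := Or.inr ⟨hcY, by
    change finrank K (Y 0 ⊓ Y 1 : Submodule K V) = n - 1
    omega⟩
  have hXn : ∀ i, finrank K (cX i).1 = i + 1 := fun i => hX _ (by omega)
  refine ⟨Set.range cX ∪ Set.range cY, ⟨?_, ?_⟩, ?_, ?_⟩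
  · rintro _ (⟨i, rfl⟩ | ⟨e, rfl⟩) _ (⟨j, rfl⟩ | ⟨f, rfl⟩)
    · exact Or.inl ((le_total i j).imp (fun h => hmono (Nat.succ_le_succ h))
        (fun h => hmono (Nat.succ_le_succ h)))
    · exact Or.inl (Or.inl (hXY _ (by omega) f))
    · exact Or.inl (Or.inr (hXY _ (by omega) e))
    · fin_cases e <;> fin_cases f
      · exact (geometryD n q M₀).inc_refl _
      · exact hinc
      · exact (geometryD n q M₀).inc_symm _ _ hinc
      · exact (geometryD n q M₀).inc_refl _
  · refine Set.eq_univ_of_forall fun t => ?_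
    rcases t with i | _ | _
    · exact ⟨_, Or.inl ⟨i, rfl⟩, hcX i⟩
    · rcases hcY with h | h
      exacts [⟨_, Or.inr ⟨0, rfl⟩, h.1⟩, ⟨_, Or.inr ⟨1, rfl⟩, h.2⟩]
    · rcases hcY with h | h
      exacts [⟨_, Or.inr ⟨1, rfl⟩, h.2⟩, ⟨_, Or.inr ⟨0, rfl⟩, h.1⟩]
  · rintro _ (⟨i, rfl⟩ | ⟨e, rfl⟩) _ (⟨j, rfl⟩ | ⟨f, rfl⟩) k hk hlt
    -- A rational subspace below a non-maximal member of the chamber is also below `Y 0`.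
    · rintro ⟨U, hU, h1, h2⟩
      exact hrat (i + 1) 0 (by omega) ⟨U, hU, h1, h2.trans (hXY _ (by omega) 0)⟩
    · exact hrat (i + 1) f (by omega)
    · rcases hcYmax e with h | h <;> rw [h] at hk <;> cases hk
    · rcases hcYmax e with h | h <;> rw [h] at hk <;> cases hk
  -- A rational `Y e` would itself be a rational subspace between `X 1` and `Y e`.
  · have key : ¬ RationalNear E K₀ (Y 0) (Y 1) := by
      rintro (h | h | ⟨W, h1, h2, h3⟩)
      · exact hrat 1 0 le_rfl ⟨_, h, hXY _ (by omega) 0, le_rfl⟩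
      · exact hrat 1 1 le_rfl ⟨_, h, hXY _ (by omega) 1, le_rfl⟩
      · exact hW W h1 h2 h3
    rintro _ (⟨i, rfl⟩ | ⟨e, rfl⟩) _ (⟨j, rfl⟩ | ⟨f, rfl⟩) hx hy hne
    · rw [hXn] at hx; omega
    · rw [hXn] at hx; omega
    · rw [hXn] at hy; omega
    · fin_cases e <;> fin_cases f
      · exact absurd rfl hne
      · exact key
      · exact fun h => key h.symm
      · exact absurd rfl hne

theorem not_generates_typeD (hE : IsHyperbolicBasis q E) (hn : 3 ≤ n) {J : Set (NodeD n)}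
    (hJ : J.Nontrivial) (hK : K₀ ≠ ⊤) (hM₀ : IsTotallySingular q M₀) (hM₀n : finrank K M₀ = n) :
    ¬ ((geometryD n q M₀).grassmannian (diagramD n) J).Generates
      (rationalPointsD q M₀ E K₀ J) := by
  have : Module.Finite K V := Module.Finite.of_basis E
  obtain ⟨C, hC, hC1, hC2⟩ := hE.exists_chamber hn hK hM₀ hM₀n
  -- Covers every pair of nodes with at least one low node, `i` being the one of smaller dimension.
  -- Only the pair `+`, `-` is left.
  have key : ∀ (i : Fin (n - 2)) (k : NodeD n), .low i ∈ J → k ∈ J →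
      (∀ y, (geometryD n q M₀).typ y = k → i.val + 1 < finrank K y.1) →
      (geometryD n q M₀).ClosedAt (diagramD n) k (.low i)
        (fun y x => RationalBetween E K₀ x.1 y.1) →
      ¬ ((geometryD n q M₀).grassmannian (diagramD n) J).Generates
        (rationalPointsD q M₀ E K₀ J) := by
    intro i k hi hk hik hcl
    have hlt : ∀ x y, (geometryD n q M₀).typ x = .low i → (geometryD n q M₀).typ y = k →
        finrank K x.1 < finrank K y.1 := fun x y hx hy => by
      rw [geometryD_finrank_low hx]; exact hik y hy
    refine TypedGeometry.not_generates_of_closedAt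
      (T := fun x : (geometryD n q M₀).Elem => IsRational E K₀ x.1)
      (closedAt_left_typeD E) hcl hi hk ?_ ?_ hC
      fun x hx y hy hxi hyk => hC1 x hx y hy i hxi (hlt x y hxi hyk)
    · obtain ⟨x, -, hx⟩ : k ∈ (geometryD n q M₀).typ '' C := by rw [hC.2]; trivial
      intro h
      exact (hlt x x (hx.trans h.symm) hx).false
    · intro x y hxy hx hy hxr _
      exact ⟨x.1, hxr, le_rfl, geometryD_le_of_inc hxy (hlt x y hx hy)⟩
  have key_low : ∀ i k : Fin (n - 2), i < k → .low i ∈ J → .low k ∈ J →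
      ¬ ((geometryD n q M₀).grassmannian (diagramD n) J).Generates
        (rationalPointsD q M₀ E K₀ J) := fun i k hik hi hk =>
    key i _ hi hk (fun y hy => by
      have : i.val < k.val := hik
      rw [geometryD_finrank_low hy]; omega) (closedAt_low_right_typeD E hik)
  have key_max : ∀ (i : Fin (n - 2)) (k : NodeD n), k = .plus ∨ k = .minus → .low i ∈ J → k ∈ J →
      ¬ ((geometryD n q M₀).grassmannian (diagramD n) J).Generates
        (rationalPointsD q M₀ E K₀ J) := fun i k hk hi hkJ =>
    key i k hi hkJ (fun y hy => by
      rw [geometryD_finrank_max (hy ▸ hk)]; omega) (hE.closedAt_max_right hn hM₀ hM₀n hk)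
  have key_max_max : .plus ∈ J → .minus ∈ J →
      ¬ ((geometryD n q M₀).grassmannian (diagramD n) J).Generates
        (rationalPointsD q M₀ E K₀ J) := by
    intro hp hm
    have hcl := hE.closedAt_max_max (K₀ := K₀) hn hM₀ hM₀n (k := .minus) (i := .plus)
      (Or.inr rfl) (Or.inl rfl) (by simp)
    refine TypedGeometry.not_generates_of_closedAt
      (T := fun x : (geometryD n q M₀).Elem => IsRational E K₀ x.1)
      (hE.closedAt_max_max (K₀ := K₀) hn hM₀ hM₀n (k := .plus) (i := .minus)
        (Or.inl rfl) (Or.inr rfl) (by simp)) ?_ hp hm (by simp)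
      (fun _ _ _ _ _ hx _ => Or.inl hx) hC
      fun x hx y hy hxi hyk => hC2 x hx y hy (geometryD_finrank_max (Or.inl hxi))
        (geometryD_finrank_max (Or.inr hyk)) (by rw [hxi, hyk]; simp)
    intro x x' x'' y hx hx' hx'' hy hne h h' h'' hadj hG hG'
    exact (hcl x x' x'' y hx hx' hx'' hy hne h h' h'' hadj hG.symm hG'.symm).symm
  obtain ⟨a, ha, b, hb, hab⟩ := hJ
  rcases a with i | _ | _ <;> rcases b with k | _ | _
  · rcases lt_trichotomy i k with h | h | h
    · exact key_low i k h ha hb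
    · exact absurd (congrArg _ h) hab
    · exact key_low k i h hb ha
  · exact key_max i _ (Or.inl rfl) ha hb
  · exact key_max i _ (Or.inr rfl) ha hb
  · exact key_max k _ (Or.inl rfl) hb ha
  · exact absurd rfl hab
  · exact key_max_max ha hb
  · exact key_max k _ (Or.inr rfl) hb ha
  · exact key_max_max hb ha
  · exact absurd rfl hab

end TypeD

theorem theorem1p3 :
    (∀ (n : ℕ) (K : Type u) (V : Type v) [DivisionRing K] [AddCommGroup V] [Module K V]
      (E : Module.Basis (Fin (n + 1)) K V) (J : Set (Fin n)),
      IsNonConnected (diagramA n) J →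
      ∀ K₀ : Subfield K, K₀ ≠ ⊤ →
        ¬ ((geometryA n K V).grassmannian (diagramA n) J).Generates (rationalPointsA E K₀ J)) ∧
    (∀ (n : ℕ), 3 ≤ n →
      ∀ (K : Type u) (V : Type v) [Field K] [AddCommGroup V] [Module K V]
      (q : QuadraticForm K V) (E : Module.Basis (Fin n × Fin 2) K V),
      -- `E` is a basis in which `q` has the canonical expression `x₁x₂ + ⋯ + x₂ₙ₋₁x₂ₙ`
      (∀ x : V, q x = ∑ i : Fin n, E.repr x (i, 0) * E.repr x (i, 1)) →
      ∀ M₀ : Submodule K V, IsTotallySingular q M₀ → Module.finrank K M₀ = n →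
      ∀ J : Set (NodeD n), IsNonConnected (diagramD n) J →
      ∀ K₀ : Subfield K, K₀ ≠ ⊤ →
        ¬ ((geometryD n q M₀).grassmannian (diagramD n) J).Generates
          (rationalPointsD q M₀ E K₀ J)) := by
  refine ⟨fun n K V _ _ _ E J hJ K₀ hK => not_generates_typeA E hJ.nontrivial hK, ?_⟩
  intro n hn K V _ _ _ q E hE M₀ hM₀ hM₀n J hJ K₀ hK
  have hE' : IsHyperbolicBasis q E := hE
  exact not_generates_typeD hE' hn hJ.nontrivial hK hM₀ hM₀n
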